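/- Work over $\mathbb{C}$. A curve in $\mathbb{P}^4$ means a (possibly reducible) Zariski closed subset all of whose irreducible components have dimension $1$, with its usual degree; a curve of degree $k$ in a plane means the zero locus of a nonzero form of degree $k$ on that plane. Let $d\ge 3$ be an integer and let $\Sigma\subset\mathbb{P}^4$ be a finite set of points such that, for every $k\ge 1$, no $k(d-1)+1$ points of $\Sigma$ lie on a curve of degree $k$ in $\mathbb{P}^4$. Fix a $2$-plane $\Pi\subset\mathbb{P}^4$. Then for a general line $L\subset\mathbb{P}^4$ (i.e. for all $L$ in some nonempty Zariski open subset of the Grassmannian of lines in $\mathbb{P}^4$), $L$ is disjoint from $\Sigma$ and from $\Pi$, and the projection $\phi_4:\mathbb{P}^4\dashrightarrow\Pi$ from $L$ has the following property: for every integer $k\ge 1$ with $d\ge k^2+1$, every curve of degree $k$ in $\Pi$ contains at most $k(d-1)$ points of $\phi_4(\Sigma)$. -/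

import Mathlib

open scoped LinearAlgebra.Projectivization

noncomputable section

/-- Complex projective space of dimension `n`, with homogeneous coordinates indexed by
`Fin (n + 1)`. -/
abbrev PSpace (n : ℕ) : Type := ℙ ℂ (Fin (n + 1) → ℂ)

/-- The common zeros in projective space of a set of polynomials. It is only used for sets of
homogeneous polynomials, for which it does not depend on the representatives of the points. -/
def projZeroLocus {n : ℕ} (T : Set (MvPolynomial (Fin (n + 1)) ℂ)) : Set (PSpace n) :=
  {p | ∀ f ∈ T, MvPolynomial.eval p.rep f = 0}

/-- A Zariski closed subset of projective space. -/
def IsProjAlgebraicSet {n : ℕ} (X : Set (PSpace n)) : Prop :=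
  ∃ T : Set (MvPolynomial (Fin (n + 1)) ℂ),
    (∀ f ∈ T, ∃ m : ℕ, f.IsHomogeneous m) ∧ X = projZeroLocus T

/-- The ideal of `X`: the polynomials that vanish at all homogeneous coordinate vectors
of all points of `X`. -/
def projVanishingIdeal {n : ℕ} (X : Set (PSpace n)) : Ideal (MvPolynomial (Fin (n + 1)) ℂ) :=
  MvPolynomial.vanishingIdeal ℂ
    {v : Fin (n + 1) → ℂ | ∃ hv : v ≠ 0, Projectivization.mk ℂ v hv ∈ X}

/-- The Hilbert function of `X`: the dimension of the degree `m` part of the homogeneous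
coordinate ring of `X`, that is, of the image of the forms of degree `m` in the quotient of the
polynomial ring by the ideal of `X`. -/
def hilbertFunction {n : ℕ} (X : Set (PSpace n)) (m : ℕ) : ℕ :=
  Module.finrank ℂ
    ((MvPolynomial.homogeneousSubmodule (Fin (n + 1)) ℂ m).map
      (Ideal.Quotient.mkₐ ℂ (projVanishingIdeal X)).toLinearMap)

/-- The Hilbert polynomial of `X` is `e * m + c` for some integer constant `c`. For `e > 0` this
says that `X` has dimension `1` and degree `e`. -/
def HasLinearHilbertPolynomial {n : ℕ} (X : Set (PSpace n)) (e : ℕ) : Prop :=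
  ∃ c : ℤ, ∀ᶠ m : ℕ in Filter.atTop, (hilbertFunction X m : ℤ) = (e : ℤ) * (m : ℤ) + c

/-- An irreducible curve in projective space: a Zariski closed subset that is irreducible
(its ideal is prime) and one-dimensional (its Hilbert polynomial has degree `1`). -/
structure IsIrreducibleCurve {n : ℕ} (X : Set (PSpace n)) : Prop where
  isAlgebraic : IsProjAlgebraicSet X
  isPrime : (projVanishingIdeal X).IsPrime
  dim_eq_one : ∃ e : ℕ, 0 < e ∧ HasLinearHilbertPolynomial X e

/-- A curve of degree `k` in projective space, possibly reducible or disconnected: a union of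
finitely many (and at least one) irreducible curves, the degree being the leading coefficient of
the Hilbert polynomial. -/
structure IsCurveOfDegree {n : ℕ} (X : Set (PSpace n)) (k : ℕ) : Prop where
  isCurve : ∃ S : Set (Set (PSpace n)), S.Finite ∧ S.Nonempty ∧
    (∀ Z ∈ S, IsIrreducibleCurve Z) ∧ X = ⋃₀ S
  degree_eq : HasLinearHilbertPolynomial X k

/-- A plane curve of degree `k` in the projective plane `ℙ ℂ E`, where `E` is a
three-dimensional space: the zero set of a nonzero form of degree `k` in linear coordinates on
`E`. It may be reducible or have multiple components. -/
def IsPlaneCurveOfDegree {E : Type} [AddCommGroup E] [Module ℂ E] (C : Set (ℙ ℂ E)) (k : ℕ) :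
    Prop :=
  ∃ (b : Module.Basis (Fin 3) ℂ E) (F : MvPolynomial (Fin 3) ℂ),
    F ≠ 0 ∧ F.IsHomogeneous k ∧ C = {q | MvPolynomial.eval (b.equivFun q.rep) F = 0}

/-- The point `p` lies on the projectivization of the linear subspace `U`. -/
def LiesOn {n : ℕ} (p : PSpace n) (U : Submodule ℂ (Fin (n + 1) → ℂ)) : Prop :=
  p.submodule ≤ U

theorem linearProj_rep_ne_zero {n : ℕ} {E U : Submodule ℂ (Fin (n + 1) → ℂ)} (h : IsCompl E U)
    (p : PSpace n) (hp : ¬ LiesOn p U) : Submodule.projectionOnto E U h p.rep ≠ 0 := by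
  intro h0
  apply hp
  unfold LiesOn
  rw [Projectivization.submodule_eq, Submodule.span_singleton_le_iff_mem]
  exact (Submodule.projectionOnto_apply_eq_zero_iff h).1 h0

/-- The image of a point `p` under the projection from the center `ℙ U` onto the complementary
linear space `ℙ E`, defined for `p` outside the center. -/
def projectFrom {n : ℕ} {E U : Submodule ℂ (Fin (n + 1) → ℂ)} (h : IsCompl E U)
    (p : PSpace n) (hp : ¬ LiesOn p U) : ℙ ℂ E :=
  Projectivization.mk ℂ (Submodule.projectionOnto E U h p.rep)
    (linearProj_rep_ne_zero h p hp)

/-- The image of a set of points under the projection from `ℙ U` onto `ℙ E`. -/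
def projectionImage {n : ℕ} {E U : Submodule ℂ (Fin (n + 1) → ℂ)} (h : IsCompl E U)
    (A : Set (PSpace n)) : Set (ℙ ℂ E) :=
  {q | ∃ p ∈ A, ∃ hp : ¬ LiesOn p U, projectFrom h p hp = q}

/-- The property `P` holds for a general line in `n`-dimensional projective space (lines being
two-dimensional subspaces of `ℂ ^ (n + 1)`). A line is given by a pair of linearly independent
vectors that spans it, and `P` is required on a nonempty Zariski open set of such pairs, the
nonvanishing locus of a nonzero polynomial in their coordinates. As the map from pairs to the
Grassmannian of lines is surjective and open, this means that `P` holds on a nonempty Zariski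
open subset of the Grassmannian. -/
def ForGeneralLine {n : ℕ} (P : Submodule ℂ (Fin (n + 1) → ℂ) → Prop) : Prop :=
  ∃ G : MvPolynomial (Fin 2 × Fin (n + 1)) ℂ, G ≠ 0 ∧
    ∀ u : Fin 2 → Fin (n + 1) → ℂ, LinearIndependent ℂ u →
      MvPolynomial.eval (fun ij => u ij.1 ij.2) G ≠ 0 → P (Submodule.span ℂ (Set.range u))

end

/-!
A set `S` of `k (d - 1) + 1` points of `A` whose images under the generic projection to a plane lie
on a curve of degree `k` is shown to lie on a space curve of degree at most `k`, which the
hypothesis on `A` forbids. The argument is an induction on `k` (`eventually_noForm`).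

A projection to the plane is a triple of linear forms. If the projections of `S` generically lie on
a curve of degree `k`, the coefficients of its equation can be chosen polynomial in the triple
(`exists_generic_form`), and generically it is irreducible: the images of `S` that lie on a proper
factor of degree `a` are at most `a (d - 1)` by induction (`irreducible_planePoly`). Restrict to a
two-parameter family of triples in which the forms `1`, `t` are fixed and the third one is
`y + s₀ u₀ + s₁ u₁`. Let `f_s (t, y)` be the equation of the curve with parameters `s`.
Differentiating `f_s (t, y + s₀ u₀ + s₁ u₁) = 0` at `s = 0` expresses the values of `u₀`, `u₁` at
the points of `S` by rational functions in `t`, `y` with denominator `∂f₀ / ∂y`. After this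
substitution and clearing of denominators, `f_s (t, y + s₀ u₀ + s₁ u₁)` becomes a polynomial in
`t`, `y` of degree at most `k ^ 2`. It vanishes at the images of the points of `S`, which are more
than `k * k ^ 2` in number because `k ^ 2 ≤ d - 1`, so it is divisible by the irreducible `f₀`, by a
weak form of Bézout's theorem (`dvd_of_card_common_zeros`). Hence the equations hold identically in
the function field of `f₀ = 0` (`exists_generic_point`), and `(1 : t : y : u₀ : u₁)` is the generic
point of a space curve `Z` whose projections are the curves `f_s = 0`.

The Hilbert function of `Z` at `m` is the dimension of the `m`-th power of the span of the
coordinates of the generic point (`hilbertFunction_closureOfPoint`). It is eventually concave, hence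
affine, since the coordinates are integral over `ℂ[1, t]`, and its slope is at most `k` because a
multiple of the coordinates lies in the polynomials of degree `k` modulo `f₀`
(`exists_isCurveOfDegree_closureOfPoint`). Each point of `S` lies on `Z`
(`eval_framePoint_eq_zero`): the points of `Z` with the given value of `t` have coordinates in a
finite set, so for generic `s` the only candidate with the right projection is the given point, and
lying over provides one.

The property obtained for a generic triple of forms passes to the projection to a fixed plane from
a generic line (`eventually_noForm_cramerCoords`): the latter has, by Cramer's rule, polynomial
coordinates, the property is Zariski open, and every triple that is nondegenerate on the plane is,
up to a linear change of coordinates, the projection from its kernel.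
-/

/-! ### Generic points of affine space -/

/-- The filter on `σ → ℂ` generated by the nonempty basic Zariski open sets: a property holds
eventually along it if it holds wherever some fixed nonzero polynomial does not vanish. -/
def zariskiGeneric (σ : Type) : Filter (σ → ℂ) where
  sets := {s | ∃ Q : MvPolynomial σ ℂ, Q ≠ 0 ∧ ∀ x, MvPolynomial.eval x Q ≠ 0 → x ∈ s}
  univ_sets := ⟨1, one_ne_zero, fun _ _ => trivial⟩
  sets_of_superset := by
    rintro s t ⟨Q, hQ, h⟩ hst
    exact ⟨Q, hQ, fun x hx => hst (h x hx)⟩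
  inter_sets := by
    rintro s t ⟨Q, hQ, h⟩ ⟨Q', hQ', h'⟩
    refine ⟨Q * Q', mul_ne_zero hQ hQ', fun x hx => ?_⟩
    rw [map_mul] at hx
    exact ⟨h x (left_ne_zero_of_mul hx), h' x (right_ne_zero_of_mul hx)⟩

theorem eventually_zariskiGeneric_iff {σ : Type} {P : (σ → ℂ) → Prop} :
    (∀ᶠ x in zariskiGeneric σ, P x) ↔
      ∃ Q : MvPolynomial σ ℂ, Q ≠ 0 ∧ ∀ x, MvPolynomial.eval x Q ≠ 0 → P x := Iff.rfl

theorem exists_eval_ne_zero {σ : Type} {Q : MvPolynomial σ ℂ} (hQ : Q ≠ 0) :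
    ∃ x, MvPolynomial.eval x Q ≠ 0 := by
  by_contra! h
  exact hQ (MvPolynomial.funext fun x => by rw [h x, map_zero])

instance (σ : Type) : (zariskiGeneric σ).NeBot := by
  rw [← Filter.frequently_true_iff_neBot, Filter.Frequently, eventually_zariskiGeneric_iff]
  rintro ⟨Q, hQ, h⟩
  obtain ⟨x, hx⟩ := exists_eval_ne_zero hQ
  exact h x hx trivial

theorem eventually_eval_ne_zero {σ : Type} {Q : MvPolynomial σ ℂ} (hQ : Q ≠ 0) :
    ∀ᶠ x in zariskiGeneric σ, MvPolynomial.eval x Q ≠ 0 :=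
  eventually_zariskiGeneric_iff.2 ⟨Q, hQ, fun _ h => h⟩

/-- A polynomial function that is nonzero somewhere is nonzero generically. -/
theorem eventually_ne_zero_of_eval {σ : Type} (g : (σ → ℂ) → ℂ) (Q : MvPolynomial σ ℂ)
    (hg : ∀ x, MvPolynomial.eval x Q = g x) {x₀ : σ → ℂ} (h : g x₀ ≠ 0) :
    ∀ᶠ x in zariskiGeneric σ, g x ≠ 0 := by
  have hQ : Q ≠ 0 := by
    rintro rfl
    exact h (by rw [← hg, map_zero])
  simpa only [hg] using eventually_eval_ne_zero hQ

/-- The pullback of a generic property along a polynomial map is generic, as soon as the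
polynomial witnessing it does not vanish at one point of the image. -/
theorem eventually_comp_of_eval_ne_zero {σ τ : Type} {Q : MvPolynomial τ ℂ}
    (φ : τ → MvPolynomial σ ℂ) {x₀ : σ → ℂ}
    (h : MvPolynomial.eval (fun i => MvPolynomial.eval x₀ (φ i)) Q ≠ 0) :
    ∀ᶠ x in zariskiGeneric σ, MvPolynomial.eval (fun i => MvPolynomial.eval x (φ i)) Q ≠ 0 := by
  refine eventually_ne_zero_of_eval _ (MvPolynomial.bind₁ φ Q) (fun x => ?_) h
  rw [MvPolynomial.eval, MvPolynomial.eval₂Hom_bind₁]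
  rfl

/-- Injectivity of a matrix with polynomial entries is a Zariski open condition. -/
theorem eventually_mulVec_injective {σ a b : Type} [Fintype a] [Fintype b]
    (M : Matrix a b (MvPolynomial σ ℂ)) {x₀ : σ → ℂ}
    (h : ∀ c : b → ℂ, (M.map (MvPolynomial.eval x₀)).mulVec c = 0 → c = 0) :
    ∀ᶠ x in zariskiGeneric σ,
      ∀ c : b → ℂ, (M.map (MvPolynomial.eval x)).mulVec c = 0 → c = 0 := by
  classical
  obtain ⟨g, hg⟩ := LinearMap.exists_leftInverse_of_injective
    (Matrix.toLin' (M.map (MvPolynomial.eval x₀))) (LinearMap.ker_eq_bot'.2 h)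
  -- The determinant of the product with a left inverse at `x₀` witnesses injectivity.
  set B := LinearMap.toMatrix' g with hB
  have hBM : B * M.map (MvPolynomial.eval x₀) = 1 := by
    have := congrArg LinearMap.toMatrix' hg
    rwa [LinearMap.toMatrix'_comp, LinearMap.toMatrix'_toLin', LinearMap.toMatrix'_id] at this
  have := eventually_ne_zero_of_eval (fun x => (B * M.map (MvPolynomial.eval x)).det)
    (Matrix.det (B.map (MvPolynomial.C (σ := σ)) * M : Matrix b b (MvPolynomial σ ℂ))) (fun x => by
      rw [RingHom.map_det, RingHom.mapMatrix_apply, Matrix.map_mul, Matrix.map_map]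
      congr 2
      ext i j
      simp) (x₀ := x₀) (by rw [hBM]; simp)
  filter_upwards [this] with x hx c hc
  refine Matrix.eq_zero_of_mulVec_eq_zero hx ?_
  rw [← Matrix.mulVec_mulVec, hc, Matrix.mulVec_zero]

/-- If a matrix with polynomial entries is not generically injective, its kernel contains a
nonzero vector with polynomial entries. -/
theorem exists_mulVec_eq_zero_of_not_eventually {σ a b : Type} [Fintype a] [Fintype b]
    (M : Matrix a b (MvPolynomial σ ℂ))
    (h : ¬ ∀ᶠ x in zariskiGeneric σ,
      ∀ c : b → ℂ, (M.map (MvPolynomial.eval x)).mulVec c = 0 → c = 0) :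
    ∃ c : b → MvPolynomial σ ℂ, c ≠ 0 ∧ M.mulVec c = 0 := by
  classical
  let R := MvPolynomial σ ℂ
  let K := FractionRing R
  have hinj : Function.Injective (algebraMap R K) := IsFractionRing.injective R K
  by_cases hK : ∀ c : b → K, (M.map (algebraMap R K)).mulVec c = 0 → c = 0
  · exfalso
    apply h
    obtain ⟨g, hg⟩ := LinearMap.exists_leftInverse_of_injective
      (Matrix.toLin' (M.map (algebraMap R K))) (LinearMap.ker_eq_bot'.2 hK)
    set B := LinearMap.toMatrix' g with hB
    have hBM : B * M.map (algebraMap R K) = 1 := by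
      have := congrArg LinearMap.toMatrix' hg
      rwa [LinearMap.toMatrix'_comp, LinearMap.toMatrix'_toLin', LinearMap.toMatrix'_id] at this
    obtain ⟨s, hs⟩ := IsLocalization.exist_integer_multiples_of_finite (nonZeroDivisors R)
      (fun ij : b × a => B ij.1 ij.2)
    choose B' hB' using hs
    have hBM' : (Matrix.of fun i j => B' (i, j)) * M = (s : R) • (1 : Matrix b b R) := by
      have : ((Matrix.of fun i j => B' (i, j)) * M).map (algebraMap R K) =
          ((s : R) • (1 : Matrix b b R)).map (algebraMap R K) := by
        have e1 : (Matrix.of fun i j => B' (i, j)).map (algebraMap R K) = (s : R) • B := by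
          ext i j
          simpa using hB' (i, j)
        rw [Matrix.map_mul, e1, Matrix.smul_mul, hBM]
        ext i j
        simp only [Matrix.smul_apply, Matrix.map_apply, Matrix.one_apply, smul_eq_mul,
          map_mul]
        rw [Algebra.smul_def]
        by_cases hij : i = j <;> simp [hij]
      ext1 i j
      exact hinj (congrFun (congrFun this i) j)
    filter_upwards [eventually_eval_ne_zero (nonZeroDivisors.ne_zero s.2)] with x hx c hc
    have e2 := congrArg (fun N => (N.map (MvPolynomial.eval x)).mulVec c) hBM'
    simp only [Matrix.map_mul] at e2
    rw [← Matrix.mulVec_mulVec, hc, Matrix.mulVec_zero] at e2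
    have e3 : ((s : R) • (1 : Matrix b b R)).map (MvPolynomial.eval x) =
        (MvPolynomial.eval x (s : R)) • (1 : Matrix b b ℂ) := by
      ext i j
      by_cases hij : i = j <;> simp [hij]
    rw [e3, Matrix.smul_mulVec, Matrix.one_mulVec] at e2
    exact (smul_eq_zero.1 e2.symm).resolve_left hx
  · push Not at hK
    obtain ⟨c, hc, hc0⟩ := hK
    obtain ⟨s, hs⟩ := IsLocalization.exist_integer_multiples_of_finite (nonZeroDivisors R) c
    choose c' hc' using hs
    have hs0 : algebraMap R K s ≠ 0 :=
      (map_ne_zero_iff _ hinj).2 (nonZeroDivisors.ne_zero s.2)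
    have hcc : (fun i => algebraMap R K (c' i)) = (s : R) • c := by
      ext i
      simpa using hc' i
    refine ⟨c', ?_, ?_⟩
    · rintro rfl
      apply hc0
      ext i
      have := congrFun hcc i
      simp only [Pi.zero_apply, map_zero, Pi.smul_apply, Algebra.smul_def] at this
      exact (mul_eq_zero.1 this.symm).resolve_left hs0
    · ext1 i
      apply hinj
      have := congrFun (congrArg (fun v => (s : R) • v) hc) i
      simp only [smul_zero] at this
      rw [← Matrix.mulVec_smul, ← hcc] at this
      simpa [Matrix.mulVec, dotProduct, map_sum] using this

/-! ### Bivariate polynomials and a weak form of Bézout's theorem -/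

section Bivariate

open Polynomial
open scoped Polynomial.Bivariate

/-- The bivariate polynomials of total degree at most `m`; the inner variable and the outer
variable both have weight one. -/
def totalDegreeLE (m : ℕ) : Submodule ℂ ℂ[X][Y] where
  carrier := {f | ∀ i j, m < i + j → (f.coeff j).coeff i = 0}
  add_mem' := by
    intro f g hf hg i j h
    simp [hf i j h, hg i j h]
  zero_mem' := by
    intro i j h
    simp
  smul_mem' := by
    intro c f hf i j h
    simp [hf i j h]

theorem totalDegreeLE_mono {m n : ℕ} (h : m ≤ n) : totalDegreeLE m ≤ totalDegreeLE n :=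
  fun _ hf i j hij => hf i j (by omega)

theorem monomial_mem_totalDegreeLE (c : ℂ) {i j m : ℕ} (h : i + j ≤ m) :
    (C (C c * X ^ i) * X ^ j : ℂ[X][Y]) ∈ totalDegreeLE m := by
  intro i' j' h'
  rw [coeff_C_mul_X_pow]
  split_ifs with hj
  · rw [coeff_C_mul_X_pow, if_neg (by omega)]
  · simp

theorem eq_sum_monomials (f : ℂ[X][Y]) :
    f = ∑ j ∈ f.support, ∑ i ∈ (f.coeff j).support,
      (C (C ((f.coeff j).coeff i) * X ^ i) * X ^ j : ℂ[X][Y]) := by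
  conv_lhs => rw [f.as_sum_support_C_mul_X_pow]
  refine Finset.sum_congr rfl fun j _ => ?_
  conv_lhs => rw [(f.coeff j).as_sum_support_C_mul_X_pow]
  rw [map_sum, Finset.sum_mul]

theorem mem_totalDegreeLE_iff_totalDegree {m : ℕ} {f : ℂ[X][Y]} :
    f ∈ totalDegreeLE m ↔ (Bivariate.equivMvPolynomial ℂ f).totalDegree ≤ m := by
  constructor
  · intro hf
    rw [eq_sum_monomials f]
    simp only [map_sum]
    refine MvPolynomial.totalDegree_finsetSum_le fun j _ =>
      MvPolynomial.totalDegree_finsetSum_le fun i _ => ?_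
    by_cases hij : i + j ≤ m
    · simp only [map_mul, map_pow, Bivariate.equivMvPolynomial_C_C,
        Bivariate.equivMvPolynomial_C_X, Bivariate.equivMvPolynomial_X]
      refine (MvPolynomial.totalDegree_mul _ _).trans ?_
      refine (Nat.add_le_add (MvPolynomial.totalDegree_mul _ _) le_rfl).trans ?_
      simp only [MvPolynomial.totalDegree_C, MvPolynomial.totalDegree_X_pow]
      omega
    · rw [hf i j (by omega)]
      simp
  · intro h
    rw [← (Bivariate.equivMvPolynomial ℂ).symm_apply_apply f]
    generalize Bivariate.equivMvPolynomial ℂ f = p at h ⊢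
    rw [p.as_sum, map_sum]
    refine Submodule.sum_mem _ fun e he => ?_
    have hdeg : e 0 + e 1 ≤ m := by
      have := (MvPolynomial.le_totalDegree he).trans h
      rwa [Finsupp.sum_fintype _ _ (fun _ => rfl), Fin.sum_univ_two] at this
    rw [MvPolynomial.monomial_eq, Finsupp.prod_fintype _ _ (fun _ => pow_zero _),
      Fin.prod_univ_two]
    simp only [map_mul, map_pow, Bivariate.equivMvPolynomial_symm_C,
      Bivariate.equivMvPolynomial_symm_X_0, Bivariate.equivMvPolynomial_symm_X_1]
    have := monomial_mem_totalDegreeLE (MvPolynomial.coeff e p) hdeg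
    simpa [mul_assoc] using this

theorem mul_mem_totalDegreeLE {m n : ℕ} {f g : ℂ[X][Y]} (hf : f ∈ totalDegreeLE m)
    (hg : g ∈ totalDegreeLE n) : f * g ∈ totalDegreeLE (m + n) := by
  rw [mem_totalDegreeLE_iff_totalDegree] at *
  rw [map_mul]
  exact (MvPolynomial.totalDegree_mul _ _).trans (Nat.add_le_add hf hg)

theorem pow_mem_totalDegreeLE {m : ℕ} {f : ℂ[X][Y]} (hf : f ∈ totalDegreeLE m) (n : ℕ) :
    f ^ n ∈ totalDegreeLE (n * m) := by
  rw [mem_totalDegreeLE_iff_totalDegree] at *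
  rw [map_pow]
  exact (MvPolynomial.totalDegree_pow _ _).trans (Nat.mul_le_mul_left n hf)

theorem C_mem_totalDegreeLE (c : ℂ) (m : ℕ) : (C (C c) : ℂ[X][Y]) ∈ totalDegreeLE m := by
  simpa using monomial_mem_totalDegreeLE c (i := 0) (j := 0) (m := m) (by omega)

theorem one_mem_totalDegreeLE (m : ℕ) : (1 : ℂ[X][Y]) ∈ totalDegreeLE m := by
  simpa using C_mem_totalDegreeLE 1 m

theorem C_X_mem_totalDegreeLE : (C X : ℂ[X][Y]) ∈ totalDegreeLE 1 := by
  simpa using monomial_mem_totalDegreeLE 1 (i := 1) (j := 0) (m := 1) (by omega)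

theorem X_mem_totalDegreeLE : (X : ℂ[X][Y]) ∈ totalDegreeLE 1 := by
  simpa using monomial_mem_totalDegreeLE 1 (i := 0) (j := 1) (m := 1) (by omega)

theorem derivative_mem_totalDegreeLE {m : ℕ} {f : ℂ[X][Y]} (hf : f ∈ totalDegreeLE m) :
    derivative f ∈ totalDegreeLE (m - 1) := by
  intro i j h
  have h1 : (f.coeff (j + 1)).coeff i = 0 := hf i (j + 1) (by omega)
  rw [coeff_derivative]
  have : ((j : ℂ[X]) + 1) = C ((j : ℂ) + 1) := by simp
  rw [this, coeff_mul_C, h1, zero_mul]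

theorem natDegree_le_of_mem_totalDegreeLE {m : ℕ} {f : ℂ[X][Y]} (hf : f ∈ totalDegreeLE m) :
    f.natDegree ≤ m := by
  refine natDegree_le_iff_coeff_eq_zero.2 fun j hj => ?_
  ext i
  rw [hf i j (by omega), coeff_zero]

/-- If the total degree of a product is the sum of the degrees of the factors in the outer
variable, then the factors, too, have total degree equal to their degree in the outer variable. -/
theorem mem_totalDegreeLE_of_mul {g h : ℂ[X][Y]} (hg : g ≠ 0) (hh : h ≠ 0)
    (hgh : g * h ∈ totalDegreeLE (g.natDegree + h.natDegree)) :
    g ∈ totalDegreeLE g.natDegree := by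
  rw [mem_totalDegreeLE_iff_totalDegree] at *
  rw [map_mul, MvPolynomial.totalDegree_mul_of_isDomain (by simpa using hg) (by simpa using hh)]
    at hgh
  have h1 := natDegree_le_of_mem_totalDegreeLE (mem_totalDegreeLE_iff_totalDegree.2 (le_refl
    (Bivariate.equivMvPolynomial ℂ h).totalDegree))
  omega

/-- Division with remainder by a polynomial whose top coefficient in the outer variable is
constant does not raise the total degree. -/
theorem exists_remainder {k D : ℕ} {f : ℂ[X][Y]} (hf : f ∈ totalDegreeLE k) {c : ℂ} (hc : c ≠ 0)
    (hfc : f.coeff k = C c) {Φ : ℂ[X][Y]} (hΦ : Φ ∈ totalDegreeLE D) :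
    ∃ r ∈ totalDegreeLE D, (∀ j, k ≤ j → r.coeff j = 0) ∧ f ∣ Φ - r := by
  suffices H : ∀ n, ∀ Φ ∈ totalDegreeLE D, (∀ j, n ≤ j → Φ.coeff j = 0) →
      ∃ r ∈ totalDegreeLE D, (∀ j, k ≤ j → r.coeff j = 0) ∧ f ∣ Φ - r from
    H (Φ.natDegree + 1) Φ hΦ fun j hj => coeff_eq_zero_of_natDegree_lt (by omega)
  intro n
  induction n with
  | zero => exact fun Φ hΦ h => ⟨Φ, hΦ, fun j _ => h j (Nat.zero_le j), by simp⟩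
  | succ n ih =>
    intro Φ hΦ h
    by_cases hkn : n < k
    · exact ⟨Φ, hΦ, fun j hj => h j (by omega), by simp⟩
    by_cases h0 : Φ.coeff n = 0
    · refine ih Φ hΦ fun j hj => ?_
      rcases hj.eq_or_lt with rfl | hj
      · exact h0
      · exact h j hj
    have hnD : n ≤ D := by
      by_contra hD
      apply h0
      ext i
      rw [hΦ i n (by omega), coeff_zero]
    have hlead : (C (Φ.coeff n) : ℂ[X][Y]) ∈ totalDegreeLE (D - n) := by
      intro i j hij
      rw [coeff_C]
      split_ifs with hj
      · exact hΦ i n (by omega)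
      · simp
    have hmem : C (C c⁻¹) * C (Φ.coeff n) * X ^ (n - k) * f ∈ totalDegreeLE D := by
      have := mul_mem_totalDegreeLE (mul_mem_totalDegreeLE (mul_mem_totalDegreeLE
        (C_mem_totalDegreeLE c⁻¹ 0) hlead) (pow_mem_totalDegreeLE X_mem_totalDegreeLE (n - k))) hf
      exact totalDegreeLE_mono (by omega) this
    obtain ⟨r, hr, hrk, hdvd⟩ := ih (Φ - C (C c⁻¹) * C (Φ.coeff n) * X ^ (n - k) * f)
      (Submodule.sub_mem _ hΦ hmem) (by
        intro j hj
        have e : C (C c⁻¹) * C (Φ.coeff n) * X ^ (n - k) * f =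
            C (C c⁻¹ * Φ.coeff n) * (f * X ^ (n - k)) := by
          rw [C_mul]; ring
        rw [e, coeff_sub, coeff_C_mul, coeff_mul_X_pow', if_pos (by omega)]
        rcases hj.eq_or_lt with rfl | hj
        · rw [show n - (n - k) = k by omega, hfc]
          have : (C c⁻¹ * C c : ℂ[X]) = 1 := by rw [← C_mul, inv_mul_cancel₀ hc, C_1]
          linear_combination (-Φ.coeff n) * this
        · rw [h j hj, coeff_eq_zero_of_natDegree_lt
            (lt_of_le_of_lt (natDegree_le_of_mem_totalDegreeLE hf) (by omega)), mul_zero, sub_zero])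
    refine ⟨r, hr, hrk, ?_⟩
    have := dvd_add hdvd (Dvd.intro_left (C (C c⁻¹) * C (Φ.coeff n) * X ^ (n - k)) rfl)
    convert this using 1
    ring

theorem evalEval_eq_sum_fin {k : ℕ} {r : ℂ[X][Y]} (hr : ∀ j, k ≤ j → r.coeff j = 0) (t y : ℂ) :
    r.evalEval t y = ∑ i : Fin k, y ^ (i : ℕ) * (r.coeff i).eval t := by
  have e : r = ∑ i : Fin k, C (r.coeff i) * X ^ (i : ℕ) := by
    ext1 j
    rw [finsetSum_coeff]
    simp only [coeff_C_mul_X_pow]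
    by_cases hj : j < k
    · rw [Finset.sum_eq_single ⟨j, hj⟩]
      · simp
      · intro b _ hb
        rw [if_neg]
        rintro rfl
        exact hb rfl
      · simp
    · rw [hr j (by omega), Finset.sum_eq_zero]
      intro b _
      rw [if_neg]
      omega
  conv_lhs => rw [e]
  rw [evalEval_finsetSum]
  refine Finset.sum_congr rfl fun i _ => ?_
  rw [evalEval_mul, evalEval_C, evalEval_pow, evalEval_X, mul_comm]

/-- In each term of the expansion of the determinant, the shifts `i` of the rows and `j` of the
columns cancel. -/
theorem natDegree_det_le_of_weights {k D : ℕ} (M : Matrix (Fin k) (Fin k) ℂ[X])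
    (hM : ∀ i j, M i j ≠ 0 → (M i j).natDegree + i ≤ D + j) : M.det.natDegree ≤ k * D := by
  rw [Matrix.det_apply]
  refine natDegree_sum_le_of_forall_le _ _ fun σ _ => ?_
  refine (natDegree_smul_le _ _).trans ?_
  by_cases h0 : ∃ i, M (σ i) i = 0
  · obtain ⟨i, hi⟩ := h0
    have h1 : ∏ i, M (σ i) i = 0 := Finset.prod_eq_zero (Finset.mem_univ i) hi
    exact (congrArg natDegree h1).trans_le (by simp)
  · push Not at h0
    refine (natDegree_prod_le _ _).trans ?_
    have h1 : ∑ i, ((M (σ i) i).natDegree + (σ i : ℕ)) ≤ ∑ i : Fin k, (D + (i : ℕ)) :=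
      Finset.sum_le_sum fun i _ => hM _ _ (h0 i)
    rw [Finset.sum_add_distrib, Finset.sum_add_distrib,
      Equiv.sum_comp σ (fun i : Fin k => (i : ℕ))] at h1
    simpa using h1

/-- A weak form of Bézout's theorem: the norm of `Φ` over `ℂ[X]`, modulo `f`, has degree at most
`k * D` and vanishes at the first coordinates of the common zeros. -/
theorem dvd_of_card_common_zeros {ι : Type} {k D : ℕ} (hk : 1 ≤ k) {f Φ : ℂ[X][Y]}
    (hirr : Irreducible f) (hf : f ∈ totalDegreeLE k) {c : ℂ} (hc : c ≠ 0)
    (hfc : f.coeff k = C c) (hΦ : Φ ∈ totalDegreeLE D) (S : Finset ι) (t y : ι → ℂ)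
    (ht : Set.InjOn t S) (hfS : ∀ p ∈ S, f.evalEval (t p) (y p) = 0)
    (hΦS : ∀ p ∈ S, Φ.evalEval (t p) (y p) = 0) (hS : k * D < S.card) : f ∣ Φ := by
  classical
  have hex : ∀ j : Fin k, ∃ r ∈ totalDegreeLE (D + j), (∀ i, k ≤ i → r.coeff i = 0) ∧
      f ∣ Φ * X ^ (j : ℕ) - r := fun j =>
    exists_remainder hf hc hfc (mul_mem_totalDegreeLE hΦ (by
      simpa using pow_mem_totalDegreeLE X_mem_totalDegreeLE (j : ℕ)))
  choose r hrD hrk hdvd using hex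
  set M : Matrix (Fin k) (Fin k) ℂ[X] := Matrix.of fun i j => (r j).coeff i with hM
  have hdeg : M.det.natDegree ≤ k * D := by
    refine natDegree_det_le_of_weights M fun i j hij => ?_
    by_contra hlt
    exact leadingCoeff_ne_zero.2 hij (hrD j _ i (by omega))
  -- At a common zero `(t, y)`, the powers of `y` form a nonzero vector in the left kernel.
  have hdet : M.det = 0 := by
    refine eq_zero_of_natDegree_lt_card_of_eval_eq_zero' M.det (S.image t) ?_ ?_
    · intro s hs
      obtain ⟨p, hp, rfl⟩ := Finset.mem_image.1 hs
      have hv : (fun i : Fin k => y p ^ (i : ℕ)) ≠ 0 := fun h0 => by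
        simpa using congrFun h0 ⟨0, hk⟩
      rw [← coe_evalRingHom, RingHom.map_det]
      refine Matrix.exists_vecMul_eq_zero_iff.1 ⟨_, hv, ?_⟩
      ext j
      have : (r j).evalEval (t p) (y p) = 0 := by
        obtain ⟨q, hq⟩ := hdvd j
        have := congrArg (evalEval (t p) (y p)) hq
        rw [evalEval_sub, evalEval_mul, evalEval_mul, hfS p hp, hΦS p hp] at this
        simpa using this
      rw [evalEval_eq_sum_fin (hrk j)] at this
      simpa [Matrix.vecMul, dotProduct, hM] using this
    · rw [Finset.card_image_of_injOn ht]
      omega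
  obtain ⟨v, hv, hMv⟩ := Matrix.exists_mulVec_eq_zero_iff.2 hdet
  -- A vector in the kernel is a `g` of degree less than `k` such that `f` divides `g * Φ`.
  set g : ℂ[X][Y] := ∑ j : Fin k, C (v j) * X ^ (j : ℕ) with hg
  have hgcoeff : ∀ j : Fin k, g.coeff j = v j := by
    intro j
    rw [hg, finsetSum_coeff, Finset.sum_eq_single j]
    · simp
    · intro b _ hb
      rw [coeff_C_mul_X_pow, if_neg fun h => hb (Fin.ext h.symm)]
    · simp
  have hg0 : g ≠ 0 := by
    intro h0
    apply hv
    ext1 j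
    rw [← hgcoeff, h0]
    simp
  have hgf : ¬ f ∣ g := by
    intro h
    have h1 := natDegree_le_of_dvd h hg0
    have h2 : k ≤ f.natDegree := le_natDegree_of_ne_zero (by rw [hfc]; simpa using hc)
    have h3 : g.natDegree ≤ k - 1 := by
      refine natDegree_sum_le_of_forall_le _ _ fun j _ => ?_
      exact (natDegree_C_mul_X_pow_le _ _).trans (by omega)
    omega
  have hprod : f ∣ g * Φ := by
    have h1 : ∑ j : Fin k, C (v j) * r j = 0 := by
      ext1 i
      rw [finsetSum_coeff, coeff_zero]
      simp only [coeff_C_mul]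
      by_cases hi : i < k
      · have := congrFun hMv ⟨i, hi⟩
        simpa [Matrix.mulVec, dotProduct, hM, mul_comm] using this
      · exact Finset.sum_eq_zero fun j _ => by rw [hrk j i (by omega), mul_zero]
    have h2 : g * Φ = ∑ j : Fin k, C (v j) * (Φ * X ^ (j : ℕ) - r j) := by
      simp only [mul_sub, Finset.sum_sub_distrib, h1, sub_zero]
      rw [hg, Finset.sum_mul]
      exact Finset.sum_congr rfl fun j _ => by ring
    rw [h2]
    exact Finset.dvd_sum fun j _ => (hdvd j).mul_left _
  exact (hirr.prime.dvd_or_dvd hprod).resolve_left hgf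

end Bivariate

/-! ### The closure of a point with coordinates in an extension field -/

section GenericPoint

variable {n : ℕ} {K : Type} [Field K] [Algebra ℂ K]

/-- The evaluation of polynomials at the generic point `λ x` of the line through `x`, where `λ` is
a new variable. -/
noncomputable def coneHom (x : Fin (n + 1) → K) :
    MvPolynomial (Fin (n + 1)) ℂ →ₐ[ℂ] Polynomial K :=
  MvPolynomial.aeval fun i => Polynomial.C (x i) * Polynomial.X

theorem coneHom_of_isHomogeneous (x : Fin (n + 1) → K) {m : ℕ}
    {f : MvPolynomial (Fin (n + 1)) ℂ} (hf : f.IsHomogeneous m) :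
    coneHom x f = Polynomial.C (MvPolynomial.aeval x f) * Polynomial.X ^ m := by
  rw [coneHom, MvPolynomial.aeval_def, MvPolynomial.eval₂_eq', MvPolynomial.aeval_def,
    MvPolynomial.eval₂_eq', map_sum, Finset.sum_mul]
  refine Finset.sum_congr rfl fun d hd => ?_
  have hdeg : ∑ i, d i = m := by
    have := hf (MvPolynomial.mem_support_iff.1 hd)
    rwa [Finsupp.weight_apply, Finsupp.sum_fintype _ _ (fun _ => by simp),
      Finset.sum_congr rfl (fun i _ => by simp : ∀ i ∈ Finset.univ, _ = d i)] at this
  simp only [mul_pow, Finset.prod_mul_distrib, Finset.prod_pow_eq_pow_sum, hdeg, map_mul, map_prod,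
    map_pow]
  rw [mul_assoc]
  rfl

/-- The homogeneous ideal of the closed subset of projective space whose generic point has
homogeneous coordinates `x`. -/
noncomputable def genericPointIdeal (x : Fin (n + 1) → K) :
    Ideal (MvPolynomial (Fin (n + 1)) ℂ) :=
  RingHom.ker (coneHom x)

/-- The closed subset of projective space whose generic point has homogeneous coordinates `x`, in
some extension field of `ℂ`. -/
def closureOfPoint (x : Fin (n + 1) → K) : Set (PSpace n) :=
  projZeroLocus {f | (∃ m, f.IsHomogeneous m) ∧ MvPolynomial.aeval x f = 0}

theorem isProjAlgebraicSet_closureOfPoint (x : Fin (n + 1) → K) :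
    IsProjAlgebraicSet (closureOfPoint x) :=
  ⟨_, fun _ hf => hf.1, rfl⟩

theorem mem_genericPointIdeal_of_isHomogeneous {x : Fin (n + 1) → K} {m : ℕ}
    {f : MvPolynomial (Fin (n + 1)) ℂ} (hf : f.IsHomogeneous m) :
    f ∈ genericPointIdeal x ↔ MvPolynomial.aeval x f = 0 := by
  rw [genericPointIdeal, RingHom.mem_ker, coneHom_of_isHomogeneous x hf,
    mul_eq_zero, Polynomial.C_eq_zero]
  simp only [pow_eq_zero_iff', Polynomial.X_ne_zero, false_and, or_false]

theorem aeval_homogeneousComponent_eq_zero {x : Fin (n + 1) → K}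
    {f : MvPolynomial (Fin (n + 1)) ℂ} (hf : f ∈ genericPointIdeal x) (m : ℕ) :
    MvPolynomial.aeval x (MvPolynomial.homogeneousComponent m f) = 0 := by
  rw [genericPointIdeal, RingHom.mem_ker, ← MvPolynomial.sum_homogeneousComponent f, map_sum] at hf
  have h := congrArg (fun p => Polynomial.coeff p m) hf
  simp only [Polynomial.finsetSum_coeff, Polynomial.coeff_zero] at h
  by_cases hm : m ∈ Finset.range (f.totalDegree + 1)
  · rw [Finset.sum_eq_single m] at h
    · rw [coneHom_of_isHomogeneous x (MvPolynomial.homogeneousComponent_isHomogeneous m f),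
        Polynomial.coeff_C_mul_X_pow, if_pos rfl] at h
      exact h
    · intro j _ hj
      rw [coneHom_of_isHomogeneous x (MvPolynomial.homogeneousComponent_isHomogeneous j f),
        Polynomial.coeff_C_mul_X_pow, if_neg (Ne.symm hj)]
    · exact fun h' => absurd hm h'
  · rw [MvPolynomial.homogeneousComponent_eq_zero _ _ (by simpa using hm), map_zero]

theorem eval_smul_of_isHomogeneous {m : ℕ} {σ : Type} {f : MvPolynomial σ ℂ}
    (hf : f.IsHomogeneous m) (a : ℂ) (v : σ → ℂ) :
    MvPolynomial.eval (a • v) f = a ^ m * MvPolynomial.eval v f := by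
  rw [MvPolynomial.eval_eq, MvPolynomial.eval_eq, Finset.mul_sum]
  refine Finset.sum_congr rfl fun d hd => ?_
  have hdeg : ∑ i ∈ d.support, d i = m := by
    have := hf (MvPolynomial.mem_support_iff.1 hd)
    simpa [Finsupp.weight_apply, Finsupp.sum] using this
  simp only [Pi.smul_apply, smul_eq_mul, mul_pow, Finset.prod_mul_distrib,
    Finset.prod_pow_eq_pow_sum, hdeg]
  ring

theorem eval_rep_eq_zero_iff {m : ℕ} {f : MvPolynomial (Fin (n + 1)) ℂ}
    (hf : f.IsHomogeneous m) {v : Fin (n + 1) → ℂ} (hv : v ≠ 0) :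
    MvPolynomial.eval (Projectivization.mk ℂ v hv).rep f = 0 ↔ MvPolynomial.eval v f = 0 := by
  obtain ⟨a, ha⟩ := Projectivization.exists_smul_eq_mk_rep ℂ v hv
  rw [← ha, Units.smul_def, eval_smul_of_isHomogeneous hf]
  simp

/-- The homogeneous Nullstellensatz for the closure of a point. -/
theorem projVanishingIdeal_closureOfPoint {x : Fin (n + 1) → K} (hx : x ≠ 0) :
    projVanishingIdeal (closureOfPoint x) = genericPointIdeal x := by
  have hprime : (genericPointIdeal x).IsPrime := RingHom.ker_isPrime _
  apply le_antisymm
  · intro f hf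
    obtain ⟨i, hi⟩ := Function.ne_iff.1 hx
    have hXi : (MvPolynomial.X i : MvPolynomial (Fin (n + 1)) ℂ) ∉ genericPointIdeal x := by
      rw [mem_genericPointIdeal_of_isHomogeneous (MvPolynomial.isHomogeneous_X ℂ i)]
      simpa using hi
    -- Multiplying by a coordinate takes care of the origin of the affine cone.
    have hmem : f * MvPolynomial.X i ∈
        MvPolynomial.vanishingIdeal ℂ (MvPolynomial.zeroLocus ℂ (genericPointIdeal x)) := by
      rw [MvPolynomial.mem_vanishingIdeal_iff]
      intro v hv
      by_cases hv0 : v = 0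
      · simp [hv0]
      · rw [map_mul, (MvPolynomial.mem_vanishingIdeal_iff.1 hf) v ⟨hv0, ?_⟩, zero_mul]
        rintro g ⟨⟨m, hg⟩, hgx⟩
        rw [eval_rep_eq_zero_iff hg hv0]
        exact hv g ((mem_genericPointIdeal_of_isHomogeneous hg).2 hgx)
    rw [MvPolynomial.IsPrime.vanishingIdeal_zeroLocus] at hmem
    exact (hprime.mem_or_mem hmem).resolve_right hXi
  · intro f hf
    rw [projVanishingIdeal, MvPolynomial.mem_vanishingIdeal_iff]
    rintro v ⟨hv, hvZ⟩
    rw [← MvPolynomial.sum_homogeneousComponent f, map_sum]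
    refine Finset.sum_eq_zero fun m _ => ?_
    have hm := MvPolynomial.homogeneousComponent_isHomogeneous m f
    exact (eval_rep_eq_zero_iff hm hv).1
      (hvZ _ ⟨⟨m, hm⟩, aeval_homogeneousComponent_eq_zero hf m⟩)

theorem map_aeval_homogeneousSubmodule (x : Fin (n + 1) → K) (m : ℕ) :
    (MvPolynomial.homogeneousSubmodule (Fin (n + 1)) ℂ m).map (MvPolynomial.aeval x).toLinearMap =
      Submodule.span ℂ (Set.range x) ^ m := by
  rw [← MvPolynomial.homogeneousSubmodule_one_pow, Submodule.map_pow,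
    MvPolynomial.homogeneousSubmodule_one_eq_span_X, Submodule.map_span, ← Set.range_comp]
  congr 3
  ext i
  simp

theorem hilbertFunction_closureOfPoint {x : Fin (n + 1) → K} (hx : x ≠ 0) (m : ℕ) :
    hilbertFunction (closureOfPoint x) m =
      Module.finrank ℂ ↥(Submodule.span ℂ (Set.range x) ^ m : Submodule ℂ K) := by
  rw [hilbertFunction, ← map_aeval_homogeneousSubmodule]
  set H := MvPolynomial.homogeneousSubmodule (Fin (n + 1)) ℂ m
  rw [← LinearMap.range_domRestrict, ← LinearMap.range_domRestrict,
    ← (LinearMap.quotKerEquivRange _).finrank_eq, ← (LinearMap.quotKerEquivRange _).finrank_eq]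
  have : LinearMap.ker ((Ideal.Quotient.mkₐ ℂ
      (projVanishingIdeal (closureOfPoint x))).toLinearMap.domRestrict H) =
      LinearMap.ker ((MvPolynomial.aeval x).toLinearMap.domRestrict H) := by
    ext ⟨f, hf⟩
    simp only [LinearMap.mem_ker, LinearMap.domRestrict_apply, AlgHom.toLinearMap_apply,
      Ideal.Quotient.mkₐ_eq_mk, Ideal.Quotient.eq_zero_iff_mem,
      projVanishingIdeal_closureOfPoint hx]
    exact mem_genericPointIdeal_of_isHomogeneous hf
  rw [this]

end GenericPoint

/-! ### Hilbert polynomials of closures of points -/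

section HilbertPolynomial

/-- A nondecreasing sequence of natural numbers that is eventually concave is eventually affine:
its increments are eventually nonincreasing, hence eventually constant. -/
theorem exists_eventually_eq_affine {f : ℕ → ℕ} (hf : Monotone f) {m₀ : ℕ}
    (hconc : ∀ m, m₀ ≤ m → f (m + 2) + f m ≤ 2 * f (m + 1)) :
    ∃ (e : ℕ) (c : ℤ), ∀ᶠ m : ℕ in Filter.atTop, (f m : ℤ) = e * m + c := by
  obtain ⟨N, hN, hmin⟩ : ∃ N, m₀ ≤ N ∧ ∀ m, m₀ ≤ m → f (N + 1) - f N ≤ f (m + 1) - f m := by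
    have hne : ∃ g, ∃ m, m₀ ≤ m ∧ f (m + 1) - f m = g := ⟨_, m₀, le_rfl, rfl⟩
    classical
    obtain ⟨N, hN, hNg⟩ := Nat.find_spec hne
    exact ⟨N, hN, fun m hm => hNg ▸ Nat.find_min' hne ⟨m, hm, rfl⟩⟩
  have hstep : ∀ m, N ≤ m → f (m + 1) = f m + (f (N + 1) - f N) := by
    intro m hm
    induction m, hm using Nat.le_induction with
    | base => have := hf (Nat.le_succ N); simp only [Nat.succ_eq_add_one] at this; omega
    | succ m hm ih =>
      have h1 := hconc m (by omega)
      have h2 := hmin (m + 1) (by omega)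
      have h3 := hf (Nat.le_succ (m + 1))
      simp only [Nat.succ_eq_add_one] at h3
      rw [show m + 1 + 1 = m + 2 from rfl] at *
      omega
  refine ⟨f (N + 1) - f N, f N - ((f (N + 1) - f N : ℕ) : ℤ) * N, ?_⟩
  filter_upwards [Filter.eventually_ge_atTop N] with m hm
  induction m, hm using Nat.le_induction with
  | base => ring
  | succ m hm ih =>
    rw [hstep m hm, Nat.cast_add, ih]
    push_cast
    ring

variable {K : Type} [Field K] [Algebra ℂ K]

theorem span_one_pair_mul (t : K) (N : Submodule ℂ K) :
    Submodule.span ℂ {1, t} * N = N ⊔ N.map (LinearMap.mulLeft ℂ t) := by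
  apply le_antisymm
  · rw [Submodule.mul_le]
    intro a ha b hb
    obtain ⟨r, s, rfl⟩ := Submodule.mem_span_pair.1 ha
    rw [add_mul]
    refine Submodule.add_mem_sup ?_ ?_
    · simpa using N.smul_mem r hb
    · refine ⟨s • b, N.smul_mem s hb, by simp⟩
  · refine sup_le (fun b hb => ?_) ?_
    · simpa using Submodule.mul_mem_mul (Submodule.subset_span (by simp) : (1 : K) ∈ _) hb
    · rintro _ ⟨b, hb, rfl⟩
      exact Submodule.mul_mem_mul (Submodule.subset_span (by simp)) hb

theorem pow_le_pow_succ_of_one_mem {V : Submodule ℂ K} (h1 : 1 ∈ V) (m : ℕ) :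
    V ^ m ≤ V ^ (m + 1) := by
  intro a ha
  rw [pow_succ]
  simpa using Submodule.mul_mem_mul ha h1

/-- `V ^ (m + 2)` is the sum of `V ^ (m + 1)` and `t V ^ (m + 1)`, whose intersection contains
`t V ^ m`. -/
theorem finrank_pow_concave {V : Submodule ℂ K} (hfg : V.FG) {t : K} (ht : t ≠ 0) (h1 : 1 ∈ V)
    (htV : t ∈ V) {m : ℕ} (hV : V ^ (m + 2) ≤ Submodule.span ℂ {1, t} * V ^ (m + 1)) :
    Module.finrank ℂ ↥(V ^ (m + 2)) + Module.finrank ℂ ↥(V ^ m) ≤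
      2 * Module.finrank ℂ ↥(V ^ (m + 1)) := by
  have hfin : ∀ j, Module.Finite ℂ ↥(V ^ j) := fun j => Module.Finite.iff_fg.2 (hfg.pow j)
  have hinj : Function.Injective (LinearMap.mulLeft ℂ t) := fun a b h => mul_left_cancel₀ ht h
  have hmap : ∀ N : Submodule ℂ K, Module.finrank ℂ ↥(N.map (LinearMap.mulLeft ℂ t)) =
      Module.finrank ℂ ↥N := fun N =>
    (Submodule.equivMapOfInjective _ hinj N).finrank_eq.symm
  rw [span_one_pair_mul] at hV
  have e1 := Submodule.finrank_mono hV
  have e2 := Submodule.finrank_sup_add_finrank_inf_eq (V ^ (m + 1))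
    ((V ^ (m + 1)).map (LinearMap.mulLeft ℂ t))
  have e3 : (V ^ m).map (LinearMap.mulLeft ℂ t) ≤
      V ^ (m + 1) ⊓ (V ^ (m + 1)).map (LinearMap.mulLeft ℂ t) := by
    refine le_inf ?_ (Submodule.map_mono (pow_le_pow_succ_of_one_mem h1 m))
    rintro _ ⟨b, hb, rfl⟩
    rw [pow_succ']
    exact Submodule.mul_mem_mul htV hb
  have e4 := Submodule.finrank_mono e3
  rw [hmap] at e2 e4
  omega

/-- If large powers of `P` and of `Q` lie in the ideal generated by `L`, so do large powers of
`P ⊔ Q`. -/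
theorem sup_pow_le_mul {L V P Q : Submodule ℂ K} (hP : P ≤ V) (hQ : Q ≤ V) {a b : ℕ}
    (ha : P ^ (a + 1) ≤ L * V ^ a) (hb : Q ^ (b + 1) ≤ L * V ^ b) :
    (P ⊔ Q) ^ (a + b + 1 + 1) ≤ L * V ^ (a + b + 1) := by
  rw [← Submodule.add_eq_sup, add_pow]
  refine Finset.sum_induction _ (fun N : Submodule ℂ K => N ≤ L * V ^ (a + b + 1))
    (fun _ _ => sup_le) bot_le fun i hi => ?_
  have hnat : ∀ (N : Submodule ℂ K) (j : ℕ), N * (j : Submodule ℂ K) ≤ N := by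
    intro N j
    rw [← Nat.cast_comm, ← nsmul_eq_mul]
    induction j with
    | zero => simp
    | succ j ih => rw [succ_nsmul]; exact sup_le ih le_rfl
  refine (hnat _ _).trans ?_
  have hi' : i ≤ a + b + 1 + 1 := by simpa [Nat.lt_succ_iff] using hi
  by_cases hia : a + 1 ≤ i
  · obtain ⟨j, rfl⟩ := Nat.exists_eq_add_of_le hia
    calc P ^ (a + 1 + j) * Q ^ (a + b + 1 + 1 - (a + 1 + j))
        ≤ (L * V ^ a * V ^ j) * V ^ (a + b + 1 + 1 - (a + 1 + j)) := by
          rw [pow_add]; gcongr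
      _ = L * V ^ (a + b + 1) := by
          rw [mul_assoc, mul_assoc, ← pow_add, ← pow_add]; congr 2; omega
  · obtain ⟨j, hj⟩ := Nat.exists_eq_add_of_le (show b + 1 ≤ a + b + 1 + 1 - i by omega)
    calc P ^ i * Q ^ (a + b + 1 + 1 - i)
        ≤ V ^ i * (L * V ^ b * V ^ j) := by
          rw [hj, pow_add]; gcongr
      _ = L * V ^ (a + b + 1) := by
          rw [mul_assoc, mul_left_comm, ← pow_add, ← pow_add]; congr 2; omega

/-- If each `z i` satisfies a homogeneous integral equation over `ℂ[1, t]`, then the graded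
algebra generated by `1`, `t` and the `z i` is finite over `ℂ[1, t]`. -/
theorem exists_forall_pow_succ_le {t : K} {V : Submodule ℂ K}
    (z : Fin 3 → K) (hVz : V = Submodule.span ℂ {1, t} ⊔ Submodule.span ℂ {z 0} ⊔
      Submodule.span ℂ {z 1} ⊔ Submodule.span ℂ {z 2}) {k : ℕ}
    (hz : ∀ i, z i ^ (k + 1) ∈ Submodule.span ℂ {1, t} * V ^ k) :
    ∃ m₀, ∀ m, m₀ ≤ m → V ^ (m + 1) ≤ Submodule.span ℂ {1, t} * V ^ m := by
  set L := Submodule.span ℂ {1, t}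
  have hL : L ≤ V := by rw [hVz]; exact le_sup_left.trans (le_sup_left.trans le_sup_left)
  have h0 : Submodule.span ℂ {z 0} ≤ V := by
    rw [hVz]; exact le_sup_right.trans (le_sup_left.trans le_sup_left)
  have h1 : Submodule.span ℂ {z 1} ≤ V := by rw [hVz]; exact le_sup_right.trans le_sup_left
  have h2 : Submodule.span ℂ {z 2} ≤ V := by rw [hVz]; exact le_sup_right
  have hpow : ∀ i, Submodule.span ℂ {z i} ^ (k + 1) ≤ L * V ^ k := by
    intro i
    rw [Submodule.span_pow, Set.singleton_pow, Submodule.span_singleton_le_iff_mem]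
    exact hz i
  have hL1 : L ^ (0 + 1) ≤ L * V ^ 0 := by simp
  have g0 := sup_pow_le_mul hL h0 hL1 (hpow 0)
  have g1 := sup_pow_le_mul (sup_le hL h0) h1 g0 (hpow 1)
  have g2 := sup_pow_le_mul (sup_le (sup_le hL h0) h1) h2 g1 (hpow 2)
  rw [← hVz] at g2
  generalize 0 + k + 1 + k + 1 + k + 1 = M at g2
  refine ⟨M, fun m hm => ?_⟩
  obtain ⟨j, rfl⟩ := Nat.exists_eq_add_of_le hm
  calc V ^ (M + j + 1) = V ^ (M + 1) * V ^ j := by rw [← pow_add, add_right_comm]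
    _ ≤ L * V ^ M * V ^ j := by gcongr
    _ = L * V ^ (M + j) := by rw [mul_assoc, ← pow_add]

theorem pow_add_le_pow_mul_pow {L V : Submodule ℂ K} {m₀ : ℕ}
    (hV : ∀ m, m₀ ≤ m → V ^ (m + 1) ≤ L * V ^ m) (j : ℕ) : V ^ (m₀ + j) ≤ L ^ j * V ^ m₀ := by
  induction j with
  | zero => simp
  | succ j ih =>
    calc V ^ (m₀ + (j + 1)) ≤ L * V ^ (m₀ + j) := hV _ (Nat.le_add_right _ _)
      _ ≤ L * (L ^ j * V ^ m₀) := by gcongr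
      _ = _ := by rw [← mul_assoc, pow_succ']

/-- Bound for the Hilbert function of the graded algebra generated by `V`, when a multiple of `V`
lies in a filtration `U` of linear growth. -/
theorem finrank_pow_add_le {L V : Submodule ℂ K} {m₀ k : ℕ}
    (hV : ∀ m, m₀ ≤ m → V ^ (m + 1) ≤ L * V ^ m) (U : ℕ → Submodule ℂ K)
    (hU0 : 1 ∈ U 0) (hUmul : ∀ a b, U a * U b ≤ U (a + b)) (hUfg : ∀ a, (U a).FG)
    (hUrank : ∀ a, Module.finrank ℂ ↥(U a) ≤ k * (a + 1)) (hLU : L ≤ U 1) {h : K} (hh : h ≠ 0)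
    (hhV : ∀ a ∈ V, h * a ∈ U k) (j : ℕ) :
    Module.finrank ℂ ↥(V ^ (m₀ + j)) ≤ k * (j + m₀ * k + 1) := by
  have hUpow : ∀ (N : Submodule ℂ K) (a i : ℕ), N ≤ U a → N ^ i ≤ U (i * a) := by
    intro N a i hN
    induction i with
    | zero => simpa [Submodule.one_le] using hU0
    | succ i ih =>
      rw [pow_succ, Nat.succ_mul]
      exact (mul_le_mul' ih hN).trans (hUmul _ _)
  have hspan : Submodule.span ℂ {h} * V ≤ U k := by
    rw [Submodule.mul_le]
    intro a ha b hb
    obtain ⟨r, rfl⟩ := Submodule.mem_span_singleton.1 ha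
    rw [smul_mul_assoc]
    exact (U k).smul_mem r (hhV b hb)
  have hle : (V ^ (m₀ + j)).map (LinearMap.mulLeft ℂ (h ^ m₀)) ≤ U (j + m₀ * k) := by
    calc (V ^ (m₀ + j)).map (LinearMap.mulLeft ℂ (h ^ m₀))
        ≤ Submodule.span ℂ {h} ^ m₀ * V ^ (m₀ + j) := by
          rintro _ ⟨b, hb, rfl⟩
          exact Submodule.mul_mem_mul (Submodule.pow_mem_pow _ (Submodule.mem_span_singleton_self h)
            m₀) hb
      _ ≤ Submodule.span ℂ {h} ^ m₀ * (L ^ j * V ^ m₀) := by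
          gcongr
          exact pow_add_le_pow_mul_pow hV j
      _ = L ^ j * (Submodule.span ℂ {h} * V) ^ m₀ := by rw [mul_pow, mul_left_comm]
      _ ≤ U (j * 1) * U (m₀ * k) := mul_le_mul' (hUpow _ _ _ hLU) (hUpow _ _ _ hspan)
      _ ≤ U (j + m₀ * k) := by rw [mul_one]; exact hUmul _ _
  have hinj : Function.Injective (LinearMap.mulLeft ℂ (h ^ m₀)) :=
    fun a b hab => mul_left_cancel₀ (pow_ne_zero _ hh) hab
  have : Module.Finite ℂ ↥(U (j + m₀ * k)) := Module.Finite.iff_fg.2 (hUfg _)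
  rw [(Submodule.equivMapOfInjective _ hinj (V ^ (m₀ + j))).finrank_eq]
  exact (Submodule.finrank_mono hle).trans (hUrank _)

theorem succ_le_finrank_pow {V : Submodule ℂ K} (hfg : V.FG) {t : K} (ht : Transcendental ℂ t)
    (h1 : 1 ∈ V) (htV : t ∈ V) (m : ℕ) : m + 1 ≤ Module.finrank ℂ ↥(V ^ m) := by
  have : Module.Finite ℂ ↥(V ^ m) := Module.Finite.iff_fg.2 (hfg.pow m)
  have hmem : ∀ i : Fin (m + 1), t ^ (i : ℕ) ∈ V ^ m := by
    intro i
    have : t ^ (i : ℕ) * 1 ^ (m - i) ∈ V ^ (i : ℕ) * V ^ (m - i) :=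
      Submodule.mul_mem_mul (Submodule.pow_mem_pow _ htV _) (Submodule.pow_mem_pow _ h1 _)
    rwa [one_pow, mul_one, ← pow_add, Nat.add_sub_cancel' (by omega)] at this
  have hli : LinearIndependent ℂ fun i : Fin (m + 1) => (⟨t ^ (i : ℕ), hmem i⟩ : ↥(V ^ m)) := by
    refine LinearIndependent.of_comp (V ^ m).subtype ?_
    have h := (Polynomial.basisMonomials ℂ).linearIndependent.map'
      (Polynomial.aeval (R := ℂ) t).toLinearMap
      (LinearMap.ker_eq_bot.2 (transcendental_iff_injective.1 ht))
    simpa [Function.comp_def] using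
      h.comp (fun i : Fin (m + 1) => (i : ℕ)) Fin.val_injective
  simpa using hli.fintype_card_le_finrank

/-- The closure of a point is an irreducible curve, of degree at most `k`, if its graded
coordinate algebra is finite over a polynomial ring in two variables and grows at most like
`k * m`. -/
theorem exists_isCurveOfDegree_closureOfPoint {n : ℕ} {x : Fin (n + 1) → K} {V : Submodule ℂ K}
    (hVx : Submodule.span ℂ (Set.range x) = V) {t : K} (ht : Transcendental ℂ t) (h1 : 1 ∈ V)
    (htV : t ∈ V) {m₀ k : ℕ} (hV : ∀ m, m₀ ≤ m → V ^ (m + 1) ≤ Submodule.span ℂ {1, t} * V ^ m)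
    (U : ℕ → Submodule ℂ K)
    (hU0 : 1 ∈ U 0) (hUmul : ∀ a b, U a * U b ≤ U (a + b)) (hUfg : ∀ a, (U a).FG)
    (hUrank : ∀ a, Module.finrank ℂ ↥(U a) ≤ k * (a + 1))
    (hLU : Submodule.span ℂ {1, t} ≤ U 1) {h : K} (hh : h ≠ 0)
    (hhV : ∀ a ∈ V, h * a ∈ U k) :
    ∃ e, 1 ≤ e ∧ e ≤ k ∧ IsCurveOfDegree (closureOfPoint x) e := by
  have hfg : V.FG := hVx ▸ Submodule.fg_span (Set.finite_range x)
  have hfin : ∀ j, Module.Finite ℂ ↥(V ^ j) := fun j => Module.Finite.iff_fg.2 (hfg.pow j)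
  have hx : x ≠ 0 := by
    rintro rfl
    have h0 : V ≤ ⊥ := by
      rw [← hVx, Submodule.span_le]
      rintro _ ⟨i, rfl⟩
      simp
    exact one_ne_zero ((Submodule.mem_bot ℂ).1 (h0 h1))
  have ht0 : t ≠ 0 := fun h0 => ht (h0 ▸ isAlgebraic_zero)
  have hilb : ∀ m, hilbertFunction (closureOfPoint x) m = Module.finrank ℂ ↥(V ^ m) := by
    intro m
    rw [hilbertFunction_closureOfPoint hx, hVx]
  obtain ⟨e, c, hec⟩ := exists_eventually_eq_affine (f := fun m => Module.finrank ℂ ↥(V ^ m))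
    (monotone_nat_of_le_succ fun m => Submodule.finrank_mono (pow_le_pow_succ_of_one_mem h1 m))
    (m₀ := m₀) (fun m hm => finrank_pow_concave hfg ht0 h1 htV (hV (m + 1) (by omega)))
  have he1 : 1 ≤ e := by
    by_contra h0
    have he0 : e = 0 := by omega
    obtain ⟨m, hm, hm'⟩ := (hec.and (Filter.eventually_ge_atTop c.toNat)).exists
    have := succ_le_finrank_pow hfg ht h1 htV m
    rw [he0] at hm
    have := Int.self_le_toNat c
    push_cast at hm
    omega
  have hek : e ≤ k := by
    by_contra hlt
    push Not at hlt
    obtain ⟨j, hj, hj'⟩ := (((Filter.tendsto_add_atTop_nat m₀).eventually hec).and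
      (Filter.eventually_ge_atTop ((k * (m₀ * k + 1) : ℤ) - c + 1).toNat)).exists
    have hle := finrank_pow_add_le hV U hU0 hUmul hUfg hUrank hLU hh hhV j
    rw [add_comm] at hle
    have hle' : (e : ℤ) * (j + m₀) + c ≤ k * (j + m₀ * k + 1) := by
      have := Nat.cast_le (α := ℤ).2 hle
      rw [hj] at this
      exact_mod_cast this
    have hj'' := Int.toNat_le.1 hj'
    have hek' : (k : ℤ) + 1 ≤ e := by exact_mod_cast hlt
    have h1 : ((k : ℤ) + 1) * (j + m₀) ≤ e * (j + m₀) :=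
      mul_le_mul_of_nonneg_right hek' (by positivity)
    have h2 : (0 : ℤ) ≤ k * m₀ := by positivity
    linarith
  have hlin : HasLinearHilbertPolynomial (closureOfPoint x) e :=
    ⟨c, by simpa only [hilb] using hec⟩
  refine ⟨e, he1, hek, ⟨⟨{closureOfPoint x}, Set.finite_singleton _, Set.singleton_nonempty _, ?_,
    by simp⟩, hlin⟩⟩
  rintro Z rfl
  refine ⟨isProjAlgebraicSet_closureOfPoint x, ?_, e, he1, hlin⟩
  rw [projVanishingIdeal_closureOfPoint hx]
  exact RingHom.ker_isPrime _

end HilbertPolynomial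

/-! ### From a family of plane curves to the generic point of a space curve -/

section Family

open Polynomial
open scoped Polynomial.Bivariate

/-- The exponents of the monomials of degree at most `k` in two variables. -/
def triangle (k : ℕ) : Finset (ℕ × ℕ) :=
  (Finset.range (k + 1) ×ˢ Finset.range (k + 1)).filter fun e => e.1 + e.2 ≤ k

theorem mem_triangle {k : ℕ} {e : ℕ × ℕ} : e ∈ triangle k ↔ e.1 + e.2 ≤ k := by
  simp only [triangle, Finset.mem_filter, Finset.mem_product, Finset.mem_range]
  omega

/-- The bivariate polynomial of degree at most `k` with coefficients `c`. -/
noncomputable def planePoly (k : ℕ) (c : ℕ × ℕ → ℂ) : ℂ[X][Y] :=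
  ∑ e ∈ triangle k, C (C (c e) * X ^ e.1) * X ^ e.2

theorem planePoly_mem_totalDegreeLE (k : ℕ) (c : ℕ × ℕ → ℂ) :
    planePoly k c ∈ totalDegreeLE k :=
  Submodule.sum_mem _ fun _ he => monomial_mem_totalDegreeLE _ (mem_triangle.1 he)

theorem evalEval_planePoly (k : ℕ) (c : ℕ × ℕ → ℂ) (t y : ℂ) :
    (planePoly k c).evalEval t y = ∑ e ∈ triangle k, c e * t ^ e.1 * y ^ e.2 := by
  rw [planePoly, evalEval_finsetSum]
  refine Finset.sum_congr rfl fun e _ => ?_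
  simp [evalEval_C]

theorem aevalAeval_planePoly {K : Type} [CommRing K] [Algebra ℂ K] (k : ℕ) (c : ℕ × ℕ → ℂ)
    (t y : K) : aevalAeval t y (planePoly k c) =
      ∑ e ∈ triangle k, algebraMap ℂ K (c e) * t ^ e.1 * y ^ e.2 := by
  rw [planePoly, map_sum]
  refine Finset.sum_congr rfl fun e _ => ?_
  simp

theorem coeff_planePoly_top (k : ℕ) (c : ℕ × ℕ → ℂ) :
    (planePoly k c).coeff k = C (c (0, k)) := by
  rw [planePoly, finsetSum_coeff, Finset.sum_eq_single (0, k)]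
  · simp
  · rintro ⟨i, j⟩ he hne
    rw [coeff_C_mul_X_pow, if_neg]
    rintro rfl
    have := mem_triangle.1 he
    simp only at this
    exact hne (by rw [show i = 0 by omega])
  · exact fun h => absurd (mem_triangle.2 (by simp)) h

theorem evalEval_derivative_planePoly (k : ℕ) (c : ℕ × ℕ → ℂ) (t y : ℂ) :
    (derivative (planePoly k c)).evalEval t y =
      ∑ e ∈ triangle k, c e * t ^ e.1 * (e.2 * y ^ (e.2 - 1)) := by
  rw [planePoly, derivative_sum, evalEval_finsetSum]
  refine Finset.sum_congr rfl fun e _ => ?_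
  rw [derivative_C_mul_X_pow]
  simp [evalEval_C]
  ring

theorem algHom_eq_aevalAeval {K : Type} [CommRing K] [Algebra ℂ K] (ψ : ℂ[X][Y] →ₐ[ℂ] K)
    (g : ℂ[X][Y]) : ψ g = aevalAeval (ψ (C X)) (ψ X) g :=
  (DFunLike.congr_fun ((aevalAevalEquiv ℂ K).apply_symm_apply ψ) g).symm

/-- Differentiating the condition that the point `(t, y + a u + b v)` lies on the curve with
parameters `a`, `b` gives linear equations for `u` and `v`. -/
theorem evalEval_pderiv_add {k : ℕ} (c : ℕ × ℕ → MvPolynomial (Fin 2) ℂ) {t y : ℂ}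
    (w : Fin 2 → ℂ) (h : ∀ s : Fin 2 → ℂ,
      (planePoly k fun e => MvPolynomial.eval s (c e)).evalEval t (y + ∑ i, s i * w i) = 0)
    (i : Fin 2) :
    (planePoly k fun e => MvPolynomial.eval 0 (MvPolynomial.pderiv i (c e))).evalEval t y +
      w i * (derivative (planePoly k fun e => MvPolynomial.eval 0 (c e))).evalEval t y = 0 := by
  set L : MvPolynomial (Fin 2) ℂ :=
    MvPolynomial.C y + ∑ i, MvPolynomial.X i * MvPolynomial.C (w i) with hL
  have hzero : ∑ e ∈ triangle k, c e * MvPolynomial.C (t ^ e.1) * L ^ e.2 = 0 := by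
    refine MvPolynomial.funext fun s => ?_
    rw [map_zero, ← h s, evalEval_planePoly, map_sum]
    refine Finset.sum_congr rfl fun e _ => ?_
    simp [hL]
  have hL0 : MvPolynomial.eval 0 L = y := by simp [hL]
  have hL1 : MvPolynomial.pderiv i L = MvPolynomial.C (w i) := by
    rw [hL, map_add, MvPolynomial.pderiv_C, zero_add, map_sum, Finset.sum_eq_single i]
    · simp [Derivation.leibniz]
    · intro j _ hj
      simp [Derivation.leibniz, MvPolynomial.pderiv_X_of_ne hj]
    · simp
  have hd := congrArg (fun q => MvPolynomial.eval 0 (MvPolynomial.pderiv i q)) hzero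
  simp only [map_sum, map_zero] at hd
  rw [evalEval_planePoly, evalEval_derivative_planePoly, Finset.mul_sum, ← Finset.sum_add_distrib,
    ← hd]
  refine Finset.sum_congr rfl fun e _ => ?_
  simp only [Derivation.leibniz, Derivation.leibniz_pow, MvPolynomial.pderiv_C, hL1, smul_eq_mul,
    map_add, map_mul, map_pow, MvPolynomial.eval_C, hL0, nsmul_eq_mul, map_natCast, mul_zero,
    zero_add]
  ring

/-- The polynomials of degree at most `N`, restricted to the curve traced out by `(t, y)`. -/
noncomputable def restrictedForms {K : Type} [CommRing K] [Algebra ℂ K] (t y : K) (N : ℕ) :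
    Submodule ℂ K :=
  (totalDegreeLE N).map (aevalAeval (R := ℂ) t y).toLinearMap

section restrictedForms

variable {K : Type} [CommRing K] [Algebra ℂ K] {t y : K}

theorem aevalAeval_mem_restrictedForms {N : ℕ} {g : ℂ[X][Y]} (hg : g ∈ totalDegreeLE N) :
    aevalAeval (R := ℂ) t y g ∈ restrictedForms t y N :=
  ⟨g, hg, rfl⟩

theorem restrictedForms_mul_le (a b : ℕ) :
    restrictedForms t y a * restrictedForms t y b ≤ restrictedForms t y (a + b) := by
  rw [Submodule.mul_le]
  rintro _ ⟨f, hf, rfl⟩ _ ⟨g, hg, rfl⟩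
  exact ⟨f * g, mul_mem_totalDegreeLE hf hg, by simp⟩

theorem one_mem_restrictedForms : (1 : K) ∈ restrictedForms t y 0 :=
  ⟨1, one_mem_totalDegreeLE 0, by simp⟩

theorem span_one_pair_le_restrictedForms : Submodule.span ℂ {1, t} ≤ restrictedForms t y 1 := by
  rw [Submodule.span_le]
  rintro _ (rfl | rfl)
  · exact ⟨1, one_mem_totalDegreeLE 1, by simp⟩
  · exact ⟨C X, C_X_mem_totalDegreeLE, by simp⟩

theorem restrictedForms_le_span {k : ℕ} {f : ℂ[X][Y]} (hf : f ∈ totalDegreeLE k) {c : ℂ}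
    (hc : c ≠ 0) (hfc : f.coeff k = C c) (hfy : aevalAeval (R := ℂ) t y f = 0) (N : ℕ) :
    restrictedForms t y N ≤
      Submodule.span ℂ
        (Set.range fun e : Fin k × Fin (N + 1) => t ^ (e.2 : ℕ) * y ^ (e.1 : ℕ)) := by
  rintro _ ⟨g, hg, rfl⟩
  obtain ⟨r, hr, hrk, q, hq⟩ := exists_remainder hf hc hfc hg
  have hgr : aevalAeval (R := ℂ) t y g = aevalAeval (R := ℂ) t y r := by
    rw [← sub_eq_zero, ← map_sub, hq, map_mul, hfy, zero_mul]
  rw [AlgHom.toLinearMap_apply, hgr, eq_sum_monomials r]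
  simp only [map_sum]
  refine Submodule.sum_mem _ fun j hj => Submodule.sum_mem _ fun i hi => ?_
  have hjk : j < k := by
    by_contra h
    exact mem_support_iff.1 hj (hrk j (by omega))
  have hiN : i < N + 1 := by
    by_contra h
    exact mem_support_iff.1 hi (hr i j (by omega))
  have : aevalAeval (R := ℂ) t y (C (C ((r.coeff j).coeff i) * X ^ i) * X ^ j) =
      (r.coeff j).coeff i • (t ^ i * y ^ j) := by
    simp [Algebra.smul_def, mul_assoc]
  rw [this]
  exact Submodule.smul_mem _ _ (Submodule.subset_span ⟨(⟨j, hjk⟩, ⟨i, hiN⟩), rfl⟩)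

theorem restrictedForms_fg {k : ℕ} {f : ℂ[X][Y]} (hf : f ∈ totalDegreeLE k) {c : ℂ}
    (hc : c ≠ 0) (hfc : f.coeff k = C c) (hfy : aevalAeval (R := ℂ) t y f = 0) (N : ℕ) :
    (restrictedForms t y N).FG := by
  have := FiniteDimensional.span_of_finite ℂ
    (Set.finite_range fun e : Fin k × Fin (N + 1) => t ^ (e.2 : ℕ) * y ^ (e.1 : ℕ))
  exact Module.Finite.iff_fg.1
    (Submodule.finiteDimensional_of_le (restrictedForms_le_span hf hc hfc hfy N))

theorem finrank_restrictedForms_le {k : ℕ} {f : ℂ[X][Y]} (hf : f ∈ totalDegreeLE k) {c : ℂ}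
    (hc : c ≠ 0) (hfc : f.coeff k = C c) (hfy : aevalAeval (R := ℂ) t y f = 0) (N : ℕ) :
    Module.finrank ℂ ↥(restrictedForms t y N) ≤ k * (N + 1) := by
  have := FiniteDimensional.span_of_finite ℂ
    (Set.finite_range fun e : Fin k × Fin (N + 1) => t ^ (e.2 : ℕ) * y ^ (e.1 : ℕ))
  refine (Submodule.finrank_mono (restrictedForms_le_span hf hc hfc hfy N)).trans ?_
  refine (finrank_range_le_card _).trans ?_
  simp

end restrictedForms

/-- The function field of an irreducible plane curve. -/
theorem exists_algHom_to_field {f : ℂ[X][Y]} (hf : Irreducible f) :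
    ∃ (K : Type) (_ : Field K) (_ : Algebra ℂ K) (ψ : ℂ[X][Y] →ₐ[ℂ] K),
      ∀ g, ψ g = 0 ↔ f ∣ g := by
  have hI : (Ideal.span {f}).IsPrime := (Ideal.span_singleton_prime hf.ne_zero).2 hf.prime
  have hinj : Function.Injective (algebraMap (ℂ[X][Y] ⧸ Ideal.span {f})
      (FractionRing (ℂ[X][Y] ⧸ Ideal.span {f}))) := IsFractionRing.injective _ _
  refine ⟨FractionRing (ℂ[X][Y] ⧸ Ideal.span {f}), inferInstance, inferInstance,
    (IsScalarTower.toAlgHom ℂ (ℂ[X][Y] ⧸ Ideal.span {f}) _).comp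
      (Ideal.Quotient.mkₐ ℂ (Ideal.span {f})), fun g => ?_⟩
  rw [AlgHom.comp_apply, IsScalarTower.toAlgHom_apply, map_eq_zero_iff _ hinj,
    Ideal.Quotient.mkₐ_eq_mk, Ideal.Quotient.eq_zero_iff_mem, Ideal.mem_span_singleton]

/-- Reconstruction of a space curve from a two-parameter family of its plane projections. Only
finitely many points are assumed to have their projections on the plane curves of degree `k` of
the family, but more than `k ^ 3` of them. Then the function field of one of the plane curves
contains functions `u 0`, `u 1` such that the projections of the space curve traced out by
`(t, y, u 0, u 1)` are the curves of the family. -/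
theorem exists_generic_point {ι : Type} {k : ℕ} (hk : 1 ≤ k)
    (c : ℕ × ℕ → MvPolynomial (Fin 2) ℂ)
    (hirr : Irreducible (planePoly k fun e => MvPolynomial.eval 0 (c e)))
    (htop : MvPolynomial.eval 0 (c (0, k)) ≠ 0) (S : Finset ι) (t y : ι → ℂ) (w : ι → Fin 2 → ℂ)
    (ht : Set.InjOn t S) (hS : k * (k * k) < S.card)
    (h : ∀ p ∈ S, ∀ s : Fin 2 → ℂ, (planePoly k fun e => MvPolynomial.eval s (c e)).evalEval
      (t p) (y p + ∑ i, s i * w p i) = 0) :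
    ∃ (K : Type) (_ : Field K) (_ : Algebra ℂ K) (τ η : K) (u : Fin 2 → K) (δ : K),
      Transcendental ℂ τ ∧ δ ≠ 0 ∧ δ ∈ restrictedForms τ η (k - 1) ∧
      (∀ i, δ * u i ∈ restrictedForms τ η k) ∧
      ∀ s : Fin 2 → ℂ, aevalAeval (R := ℂ) τ (η + ∑ i, algebraMap ℂ K (s i) * u i)
        (planePoly k fun e => MvPolynomial.eval s (c e)) = 0 := by
  set f := planePoly k fun e => MvPolynomial.eval 0 (c e) with hf
  have hfW : f ∈ totalDegreeLE k := planePoly_mem_totalDegreeLE _ _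
  have hfc : f.coeff k = C (MvPolynomial.eval 0 (c (0, k))) := coeff_planePoly_top _ _
  have hkf : k ≤ f.natDegree := le_natDegree_of_ne_zero (by rw [hfc]; simpa using htop)
  obtain ⟨K, _, _, ψ, hψ⟩ := exists_algHom_to_field hirr
  set τ := ψ (C X) with hτ
  set η := ψ X with hη
  have hψ' : ∀ g, ψ g = aevalAeval τ η g := algHom_eq_aevalAeval ψ
  set fY := derivative f with hfY
  set δ := ψ fY with hδ
  have hfYW : fY ∈ totalDegreeLE (k - 1) := derivative_mem_totalDegreeLE hfW
  have hδ0 : δ ≠ 0 := by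
    rw [hδ, Ne, hψ]
    intro hdvd
    have hlt : fY.natDegree < f.natDegree :=
      lt_of_le_of_lt (natDegree_le_of_mem_totalDegreeLE hfYW) (by omega)
    have h0 : fY = 0 := eq_zero_of_dvd_of_natDegree_lt hdvd hlt
    have := congrArg natDegree h0
    have h1 := derivative_eq_zero.1 h0
    omega
  set g : Fin 2 → ℂ[X][Y] := fun i =>
    planePoly k fun e => MvPolynomial.eval 0 (MvPolynomial.pderiv i (c e)) with hg
  have hgW : ∀ i, g i ∈ totalDegreeLE k := fun i => planePoly_mem_totalDegreeLE _ _
  refine ⟨K, inferInstance, inferInstance, τ, η, fun i => -ψ (g i) / δ, δ, ?_, hδ0, ?_, ?_, ?_⟩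
  · rw [transcendental_iff]
    intro p hp
    have : ψ (C p) = 0 := by rw [hψ', aevalAeval_C, hp]
    rw [hψ] at this
    exact C_eq_zero.1 (eq_zero_of_dvd_of_natDegree_lt this (by rw [natDegree_C]; omega))
  · rw [hδ, hψ']
    exact aevalAeval_mem_restrictedForms hfYW
  · intro i
    rw [mul_div_cancel₀ _ hδ0, hψ', ← map_neg]
    exact aevalAeval_mem_restrictedForms (Submodule.neg_mem _ (hgW i))
  · intro s
    -- Clearing the denominator `fY` from the equation of the curve with parameters `s`.
    set Φ : ℂ[X][Y] := ∑ e ∈ triangle k, C (C (MvPolynomial.eval s (c e)) * X ^ e.1) *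
      (fY ^ (k - e.2) * (X * fY - ∑ i, C (C (s i)) * g i) ^ e.2) with hΦ
    have hΦW : Φ ∈ totalDegreeLE (k * k) := by
      refine Submodule.sum_mem _ fun e he => ?_
      have he' := mem_triangle.1 he
      have hlin : X * fY - ∑ i, C (C (s i)) * g i ∈ totalDegreeLE k := by
        refine Submodule.sub_mem _ ?_ (Submodule.sum_mem _ fun i _ => ?_)
        · exact totalDegreeLE_mono (by omega) (mul_mem_totalDegreeLE X_mem_totalDegreeLE hfYW)
        · exact totalDegreeLE_mono (by omega)
            (mul_mem_totalDegreeLE (C_mem_totalDegreeLE (s i) 0) (hgW i))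
      have h1 : (C (C (MvPolynomial.eval s (c e)) * X ^ e.1) : ℂ[X][Y]) ∈ totalDegreeLE e.1 := by
        simpa using monomial_mem_totalDegreeLE (MvPolynomial.eval s (c e)) (i := e.1) (j := 0)
          (m := e.1) (by omega)
      refine totalDegreeLE_mono ?_ (mul_mem_totalDegreeLE h1 (mul_mem_totalDegreeLE
        (pow_mem_totalDegreeLE hfYW (k - e.2)) (pow_mem_totalDegreeLE hlin e.2)))
      obtain ⟨l, hl⟩ := Nat.exists_eq_add_of_le hk
      obtain ⟨r, hr⟩ := Nat.exists_eq_add_of_le (show e.2 ≤ k by omega)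
      have e1 : k - e.2 = r := by omega
      have e2 : k - 1 = l := by omega
      have e3 : e.1 ≤ r := by omega
      rw [e1, e2]
      calc e.1 + (r * l + e.2 * k) ≤ r + (r * l + e.2 * k) := by omega
        _ = (r + e.2) * k := by rw [hl]; ring
        _ = k * k := by rw [hr]; ring
    have hΦS : ∀ p ∈ S, Φ.evalEval (t p) (y p) = 0 := by
      intro p hp
      have hw : ∀ i, (g i).evalEval (t p) (y p) = - (w p i * fY.evalEval (t p) (y p)) :=
        fun i => eq_neg_of_add_eq_zero_left (evalEval_pderiv_add c (w p) (h p hp) i)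
      have key : Φ.evalEval (t p) (y p) = fY.evalEval (t p) (y p) ^ k *
          (planePoly k fun e => MvPolynomial.eval s (c e)).evalEval
            (t p) (y p + ∑ i, s i * w p i) := by
        rw [hΦ, evalEval_finsetSum, evalEval_planePoly, Finset.mul_sum]
        refine Finset.sum_congr rfl fun e he => ?_
        have he' := mem_triangle.1 he
        simp only [evalEval_mul, evalEval_pow, evalEval_sub, evalEval_X, evalEval_finsetSum,
          evalEval_C, eval_C, eval_mul, eval_pow, eval_X, hw]
        have e1 : y p * fY.evalEval (t p) (y p) -
            ∑ i, s i * -(w p i * fY.evalEval (t p) (y p)) =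
            fY.evalEval (t p) (y p) * (y p + ∑ i, s i * w p i) := by
          rw [Fin.sum_univ_two, Fin.sum_univ_two]; ring
        rw [e1, mul_pow, show fY.evalEval (t p) (y p) ^ k = fY.evalEval (t p) (y p) ^ (k - e.2) *
          fY.evalEval (t p) (y p) ^ e.2 by rw [← pow_add, Nat.sub_add_cancel (by omega)]]
        ring
      rw [key, h p hp s, mul_zero]
    have hfS : ∀ p ∈ S, f.evalEval (t p) (y p) = 0 := by
      intro p hp
      have := h p hp 0
      simp only [Pi.zero_apply, zero_mul, Finset.sum_const_zero, add_zero] at this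
      exact this
    have hdvd := dvd_of_card_common_zeros hk hirr hfW htop hfc hΦW S t y ht hfS hΦS hS
    rw [← hψ] at hdvd
    have key : ψ Φ = δ ^ k * aevalAeval (R := ℂ) τ (η + ∑ i, algebraMap ℂ K (s i) *
        (-ψ (g i) / δ)) (planePoly k fun e => MvPolynomial.eval s (c e)) := by
      rw [hΦ, map_sum, aevalAeval_planePoly, Finset.mul_sum]
      refine Finset.sum_congr rfl fun e he => ?_
      have he' := mem_triangle.1 he
      have hC : ∀ a : ℂ, ψ (C (C a)) = algebraMap ℂ K a := fun a => ψ.commutes a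
      simp only [map_mul, map_pow, map_sub, map_sum, hC, ← hτ, ← hη, ← hδ]
      have e1 : η * δ - ∑ i, algebraMap ℂ K (s i) * ψ (g i) =
          δ * (η + ∑ i, algebraMap ℂ K (s i) * (-ψ (g i) / δ)) := by
        rw [Fin.sum_univ_two, Fin.sum_univ_two]; field_simp; ring
      rw [e1, mul_pow, show δ ^ k = δ ^ (k - e.2) * δ ^ e.2 by
        rw [← pow_add, Nat.sub_add_cancel (by omega)]]
      ring
    rw [key] at hdvd
    exact (mul_eq_zero.1 hdvd).resolve_left (pow_ne_zero _ hδ0)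

end Family

/-! ### Lying over -/

section LyingOver

open Polynomial
open scoped Polynomial.Bivariate

theorem map_aevalAeval {A B : Type} [CommRing A] [CommRing B] [Algebra ℂ A] [Algebra ℂ B]
    (φ : A →ₐ[ℂ] B) (a b : A) (f : ℂ[X][Y]) :
    φ (aevalAeval a b f) = aevalAeval (φ a) (φ b) f := by
  have := algHom_eq_aevalAeval (φ.comp (aevalAeval (R := ℂ) a b)) f
  simpa using this

theorem eval₂_aeval_eq_aevalAeval {K : Type} [CommRing K] [Algebra ℂ K] (τ θ : K) (f : ℂ[X][Y]) :
    eval₂ (aeval (R := ℂ) τ).toRingHom θ f = aevalAeval τ θ f := by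
  conv_lhs => rw [eq_sum_monomials f]
  conv_rhs => rw [eq_sum_monomials f]
  simp only [eval₂_finsetSum, map_sum]
  refine Finset.sum_congr rfl fun j _ => Finset.sum_congr rfl fun i _ => ?_
  rw [eval₂_mul, eval₂_C, eval₂_X_pow]
  change aeval τ (C ((f.coeff j).coeff i) * X ^ i) * θ ^ j = _
  simp

theorem isIntegralElem_of_aevalAeval_eq_zero {K : Type} [CommRing K] [Algebra ℂ K] {τ θ : K}
    {k : ℕ} {f : ℂ[X][Y]} (hf : f ∈ totalDegreeLE k) {c : ℂ} (hc : c ≠ 0) (hfc : f.coeff k = C c)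
    (h : aevalAeval (R := ℂ) τ θ f = 0) : (aeval (R := ℂ) τ).toRingHom.IsIntegralElem θ := by
  refine ⟨C (C c⁻¹) * f, ?_, ?_⟩
  · refine monic_of_natDegree_le_of_coeff_eq_one k ?_ ?_
    · exact (natDegree_C_mul_le _ _).trans (natDegree_le_of_mem_totalDegreeLE hf)
    · rw [coeff_C_mul, hfc, ← C_mul, inv_mul_cancel₀ hc, C_1]
  · rw [eval₂_mul, eval₂_aeval_eq_aevalAeval τ θ f, h, mul_zero]

/-- An irreducible polynomial, monic up to a constant, generates the ideal of relations between a
transcendental element and a root. -/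
theorem dvd_of_aevalAeval_eq_zero {K : Type} [Field K] [Algebra ℂ K] {τ θ : K}
    (hτ : Transcendental ℂ τ) {k : ℕ} {f : ℂ[X][Y]} (hf : f ∈ totalDegreeLE k) {c : ℂ}
    (hc : c ≠ 0) (hfc : f.coeff k = C c) (hirr : Irreducible f)
    (h : aevalAeval (R := ℂ) τ θ f = 0) {g : ℂ[X][Y]} (hg : aevalAeval (R := ℂ) τ θ g = 0) :
    f ∣ g := by
  let : Algebra ℂ[X] K := (aeval (R := ℂ) τ).toRingHom.toAlgebra
  have hfaith : FaithfulSMul ℂ[X] K :=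
    (faithfulSMul_iff_algebraMap_injective ℂ[X] K).2 (transcendental_iff_injective.1 hτ)
  have hint : IsIntegral ℂ[X] θ := isIntegralElem_of_aevalAeval_eq_zero hf hc hfc h
  have haev : ∀ q : ℂ[X][Y], aeval θ q = aevalAeval (R := ℂ) τ θ q :=
    fun q => eval₂_aeval_eq_aevalAeval τ θ q
  have hmf := minpoly.isIntegrallyClosed_dvd hint (p := f) (by rw [haev, h])
  have hmg := minpoly.isIntegrallyClosed_dvd hint (p := g) (by rw [haev, hg])
  exact ((minpoly.irreducible hint).associated_of_dvd hirr hmf).symm.dvd.trans hmg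

/-- Lying over: a point `(t, y)` of the plane curve traced out by `(τ, θ)` lifts to a point of
the affine variety traced out by `z`, if the coordinates `z` are integral over `ℂ[τ, θ]`. -/
theorem exists_point_lying_over {σ : Type} [Finite σ] {K : Type} [Field K] [Algebra ℂ K] {τ θ : K}
    (z : σ → K) (hz : ∀ i, (aeval (R := ℂ) τ).toRingHom.IsIntegralElem (z i)) {t y : ℂ}
    (hker : ∀ g : ℂ[X][Y], aevalAeval (R := ℂ) τ θ g = 0 → g.evalEval t y = 0) :
    ∃ ζ : σ → ℂ, ∀ (g : MvPolynomial σ ℂ) (h : ℂ[X][Y]),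
      MvPolynomial.aeval z g = aevalAeval τ θ h → MvPolynomial.eval ζ g = h.evalEval t y := by
  let : Algebra ℂ[X][Y] K := (aevalAeval (R := ℂ) τ θ).toRingHom.toAlgebra
  have hint : ∀ i, IsIntegral ℂ[X][Y] (z i) := by
    intro i
    obtain ⟨q, hq, hqz⟩ := hz i
    refine ⟨q.map C, hq.map C, ?_⟩
    have hcomp : (algebraMap ℂ[X][Y] K).comp C = (aeval (R := ℂ) τ).toRingHom :=
      RingHom.ext fun p => aevalAeval_C τ θ p
    rw [eval₂_map, hcomp, hqz]
  let R := integralClosure ℂ[X][Y] K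
  let P : Ideal ℂ[X][Y] := RingHom.ker (evalEvalRingHom t y)
  have hP : P.IsPrime := RingHom.ker_isPrime _
  obtain ⟨Q, -, hQ, hQP⟩ := Ideal.exists_ideal_over_prime_of_isIntegral (S := R) P ⊥ (by
    intro g hg
    have : algebraMap ℂ[X][Y] R g = 0 := hg
    exact hker g (congrArg Subtype.val this))
  let φ : MvPolynomial σ ℂ →+* R :=
    MvPolynomial.eval₂Hom ((algebraMap ℂ[X][Y] R).comp (algebraMap ℂ ℂ[X][Y]))
      fun i => ⟨z i, hint i⟩
  have hφ : ∀ g, (φ g : K) = MvPolynomial.aeval z g := by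
    intro g
    have : (R.val.toRingHom.comp φ) =
        (MvPolynomial.aeval z : MvPolynomial σ ℂ →ₐ[ℂ] K).toRingHom := by
      apply MvPolynomial.ringHom_ext
      · intro a
        simp only [RingHom.comp_apply, φ, MvPolynomial.eval₂Hom_C]
        refine Eq.trans ?_ (MvPolynomial.aeval_C z a).symm
        exact (aevalAeval (R := ℂ) τ θ).commutes a
      · intro i
        simp [φ]
    exact DFunLike.congr_fun this g
  have hcomap : (Q.comap φ) ≠ ⊤ := (hQ.comap φ).ne_top
  obtain ⟨M, hM, hQM⟩ := Ideal.exists_le_maximal _ hcomap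
  obtain ⟨ζ, rfl⟩ := MvPolynomial.isMaximal_iff_eq_vanishingIdeal_singleton.1 hM
  refine ⟨ζ, fun g h hgh => ?_⟩
  have hmem : g - MvPolynomial.C (h.evalEval t y) ∈ Q.comap φ := by
    have h1 : φ (g - MvPolynomial.C (h.evalEval t y)) =
        algebraMap ℂ[X][Y] R (h - C (C (h.evalEval t y))) := by
      apply Subtype.ext
      rw [hφ, map_sub, hgh, MvPolynomial.aeval_C]
      change _ = aevalAeval (R := ℂ) τ θ (h - C (C (h.evalEval t y)))
      rw [map_sub]
      congr 1
      exact ((aevalAeval (R := ℂ) τ θ).commutes _).symm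
    rw [Ideal.mem_comap, h1, ← Ideal.mem_comap, hQP]
    change evalEval t y _ = 0
    rw [evalEval_sub, evalEval_CC, sub_self]
  have := hQM hmem
  rw [MvPolynomial.mem_vanishingIdeal_singleton_iff] at this
  simpa [sub_eq_zero] using this

end LyingOver

/-! ### The space curve of a family of plane curves -/

section CurveOfFamily

open Polynomial
open scoped Polynomial.Bivariate

/-- The point of a four-dimensional projective space whose third, fourth and fifth coordinate are
the images of `(t, y, u)` under three of the projections of the two-parameter family. -/
def framePoint {R : Type} [CommRing R] (t y : R) (u : Fin 2 → R) : Fin 5 → R :=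
  ![1, t, y, y + u 0, y + u 1]

/-- The parameters of the projections that give the last three coordinates of `framePoint`. -/
def corner : Fin 3 → Fin 2 → ℂ :=
  ![0, Pi.single 0 1, Pi.single 1 1]

theorem framePoint_eq_corner {R : Type} [CommRing R] [Algebra ℂ R] (t y : R) (u : Fin 2 → R)
    (j : Fin 3) :
    framePoint t y u (j.natAdd 2) = y + ∑ i, algebraMap ℂ R (corner j i) * u i := by
  fin_cases j <;> simp [framePoint, corner, Fin.sum_univ_two, Fin.natAdd]

theorem framePoint_one {R : Type} [CommRing R] (t y : R) (u : Fin 2 → R) :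
    framePoint t y u 1 = t := rfl

theorem pow_succ_mem_of_aevalAeval_eq_zero {K : Type} [Field K] [Algebra ℂ K] {τ θ : K}
    {V : Submodule ℂ K} (h1 : 1 ∈ V) (hτ : τ ∈ V) (hθ : θ ∈ V) {k : ℕ} {c : ℕ × ℕ → ℂ}
    (hc : c (0, k + 1) ≠ 0) (h : aevalAeval (R := ℂ) τ θ (planePoly (k + 1) c) = 0) :
    θ ^ (k + 1) ∈ Submodule.span ℂ {1, τ} * V ^ k := by
  set L : Submodule ℂ K := Submodule.span ℂ {1, τ}
  have hL1 : (1 : K) ∈ L := Submodule.subset_span (by simp)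
  have hLτ : τ ∈ L := Submodule.subset_span (by simp)
  have hLV : L ≤ V := by
    rw [Submodule.span_le]
    rintro _ (rfl | rfl) <;> assumption
  rw [aevalAeval_planePoly, ← Finset.add_sum_erase _ _
    (mem_triangle.2 (by simp) : ((0, k + 1) : ℕ × ℕ) ∈ triangle (k + 1))] at h
  have h2 : θ ^ (k + 1) = (-(c (0, k + 1))⁻¹) • ∑ e ∈ (triangle (k + 1)).erase (0, k + 1),
      algebraMap ℂ K (c e) * τ ^ e.1 * θ ^ e.2 := by
    rw [eq_neg_of_add_eq_zero_right h]
    simp only [pow_zero, mul_one, neg_smul, smul_neg, neg_neg]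
    rw [← Algebra.smul_def, smul_smul, inv_mul_cancel₀ hc, one_smul]
  rw [h2]
  refine Submodule.smul_mem _ _ (Submodule.sum_mem _ fun e he => ?_)
  obtain ⟨hne, he⟩ := Finset.mem_erase.1 he
  have he' := mem_triangle.1 he
  obtain ⟨i, j⟩ := e
  simp only at he' ⊢
  have hj : j ≤ k := by
    by_contra hj
    exact hne (by rw [show i = 0 by omega, show j = k + 1 by omega])
  rw [mul_assoc, ← Algebra.smul_def]
  refine Submodule.smul_mem _ _ ?_
  have hi : τ ^ i ∈ L ^ (k - j + 1) := by
    have : τ ^ i * 1 ^ (k - j + 1 - i) ∈ L ^ i * L ^ (k - j + 1 - i) :=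
      Submodule.mul_mem_mul (Submodule.pow_mem_pow _ hLτ _) (Submodule.pow_mem_pow _ hL1 _)
    rwa [one_pow, mul_one, ← pow_add, Nat.add_sub_cancel' (by omega)] at this
  have hle : L ^ (k - j + 1) * V ^ j ≤ L * V ^ k := by
    calc L ^ (k - j + 1) * V ^ j ≤ L * V ^ (k - j) * V ^ j := by
          rw [pow_succ']; gcongr
      _ = L * V ^ k := by rw [mul_assoc, ← pow_add, Nat.sub_add_cancel hj]
  exact hle (Submodule.mul_mem_mul hi (Submodule.pow_mem_pow _ hθ _))

/-- A point all of whose projections lie on the plane curves of the family specializes the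
generic point of the reconstructed space curve. -/
theorem eval_framePoint_eq_zero {K : Type} [Field K] [Algebra ℂ K] {τ η : K} {u : Fin 2 → K}
    (hτ : Transcendental ℂ τ) {k : ℕ} {c : ℕ × ℕ → MvPolynomial (Fin 2) ℂ}
    (hu : ∀ s : Fin 2 → ℂ, aevalAeval (R := ℂ) τ (η + ∑ i, algebraMap ℂ K (s i) * u i)
        (planePoly k fun e => MvPolynomial.eval s (c e)) = 0)
    (htop : ∀ j, MvPolynomial.eval (corner j) (c (0, k)) ≠ 0)
    (hgen : ∀ᶠ s in zariskiGeneric (Fin 2),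
      Irreducible (planePoly k fun e => MvPolynomial.eval s (c e)) ∧
        MvPolynomial.eval s (c (0, k)) ≠ 0)
    {t y : ℂ} {w : Fin 2 → ℂ}
    (h : ∀ s : Fin 2 → ℂ, (planePoly k fun e => MvPolynomial.eval s (c e)).evalEval
      t (y + ∑ i, s i * w i) = 0)
    {g : MvPolynomial (Fin 5) ℂ} (hg : MvPolynomial.aeval (framePoint τ η u) g = 0) :
    MvPolynomial.eval (framePoint t y w) g = 0 := by
  set z := framePoint τ η u with hz
  -- The lifts of `t` to the space curve have last three coordinates in the finite sets `F j`.
  set F : Fin 3 → Set ℂ := fun j =>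
    {a | (planePoly k fun e => MvPolynomial.eval (corner j) (c e)).evalEval t a = 0} with hF
  have hFfin : ∀ j, (F j).Finite := by
    intro j
    set q := (planePoly k fun e => MvPolynomial.eval (corner j) (c e)).map (evalRingHom t) with hq
    have hq0 : q ≠ 0 := by
      intro h0
      have := congrArg (fun r => r.coeff k) h0
      simp only [hq, coeff_map, coeff_planePoly_top, coeff_zero, coe_evalRingHom, eval_C] at this
      exact htop j this
    refine (q.roots.toFinset.finite_toSet).subset fun a ha => ?_
    simp only [Finset.mem_coe, Multiset.mem_toFinset]
    rw [mem_roots hq0, IsRoot.def, hq, map_evalRingHom_eval]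
    exact ha
  have hsep : ∀ᶠ s in zariskiGeneric (Fin 2), ∀ ξ ∈ Set.pi Set.univ F,
      (ξ 0 - y) + ∑ i : Fin 2, s i * (ξ i.succ - ξ 0 - w i) = 0 →
        ξ 0 = y ∧ ∀ i : Fin 2, ξ i.succ - ξ 0 = w i := by
    refine (Filter.eventually_all_finite (Set.Finite.pi hFfin)).2 fun ξ _ => ?_
    by_cases hξ : ξ 0 = y ∧ ∀ i : Fin 2, ξ i.succ - ξ 0 = w i
    · exact Filter.Eventually.of_forall fun s _ => hξ
    · have hex : ∃ s : Fin 2 → ℂ,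
          (ξ 0 - y) + ∑ i : Fin 2, s i * (ξ i.succ - ξ 0 - w i) ≠ 0 := by
        by_contra! hall
        have h0 : ξ 0 - y = 0 := by simpa using hall 0
        refine hξ ⟨sub_eq_zero.1 h0, fun i => ?_⟩
        have := hall (Pi.single i 1)
        rw [h0, zero_add, Finset.sum_eq_single i (fun j _ hj => by simp [Pi.single_eq_of_ne hj])
          (by simp)] at this
        simpa [sub_eq_zero] using this
      obtain ⟨s₀, hs₀⟩ := hex
      filter_upwards [eventually_ne_zero_of_eval
        (fun s : Fin 2 → ℂ => (ξ 0 - y) + ∑ i : Fin 2, s i * (ξ i.succ - ξ 0 - w i))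
        (MvPolynomial.C (ξ 0 - y) + ∑ i : Fin 2, MvPolynomial.X i *
          MvPolynomial.C (ξ i.succ - ξ 0 - w i)) (fun s => by simp) hs₀] with s hs hs'
      exact absurd hs' hs
  -- Choose `s` such that a lift with the same projection along `s` as the given point equals it.
  obtain ⟨s, ⟨hirr, htops⟩, hs⟩ := (hgen.and hsep).exists
  have hzint : ∀ i, (aeval (R := ℂ) τ).toRingHom.IsIntegralElem (z i) := by
    intro i
    refine Fin.addCases (m := 2) (n := 3) (fun i => ?_) (fun j => ?_) i
    · fin_cases i
      · exact RingHom.isIntegralElem_one _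
      · have := RingHom.isIntegralElem_map (aeval (R := ℂ) τ).toRingHom (x := X)
        rwa [AlgHom.toRingHom_eq_coe, RingHom.coe_coe, aeval_X] at this
    · rw [hz, framePoint_eq_corner]
      exact isIntegralElem_of_aevalAeval_eq_zero (planePoly_mem_totalDegreeLE k _) (htop j)
        (coeff_planePoly_top k _) (hu (corner j))
  obtain ⟨ζ, hζ⟩ := exists_point_lying_over (τ := τ)
    (θ := η + ∑ i, algebraMap ℂ K (s i) * u i) z hzint (t := t) (y := y + ∑ i, s i * w i) (by
      intro q hq
      obtain ⟨r, rfl⟩ := dvd_of_aevalAeval_eq_zero hτ (planePoly_mem_totalDegreeLE k _) htops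
        (coeff_planePoly_top k _) hirr (hu s) hq
      rw [evalEval_mul, h s, zero_mul])
  have hζ0 : ζ 0 = 1 := by
    have := hζ (MvPolynomial.X 0) 1 (by simp [hz, framePoint])
    simpa using this
  have hζ1 : ζ 1 = t := by
    have := hζ (MvPolynomial.X 1) (C X) (by simp [hz, framePoint])
    simpa [evalEval_C] using this
  have hζF : (fun j : Fin 3 => ζ (j.natAdd 2)) ∈ Set.pi Set.univ F := by
    intro j _
    have h1 := hζ (aevalAeval (MvPolynomial.X 1) (MvPolynomial.X (j.natAdd 2))
      (planePoly k fun e => MvPolynomial.eval (corner j) (c e))) 0 (by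
        rw [map_aevalAeval, MvPolynomial.aeval_X, MvPolynomial.aeval_X, hz, framePoint_eq_corner,
          framePoint_one, hu (corner j), map_zero])
    have h2 := map_aevalAeval (MvPolynomial.aeval ζ : MvPolynomial (Fin 5) ℂ →ₐ[ℂ] ℂ)
      (MvPolynomial.X 1) (MvPolynomial.X (j.natAdd 2))
      (planePoly k fun e => MvPolynomial.eval (corner j) (c e))
    rw [MvPolynomial.aeval_X, MvPolynomial.aeval_X, hζ1, coe_aevalAeval_eq_evalEval,
      MvPolynomial.aeval_eq_eval] at h2
    rw [evalEval_zero] at h1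
    exact h2.symm.trans h1
  have hζs : (ζ 2 - y) + ∑ i : Fin 2, s i * (ζ (i.succ.natAdd 2) - ζ 2 - w i) = 0 := by
    have := hζ (MvPolynomial.X 2 + ∑ i : Fin 2, MvPolynomial.C (s i) *
      (MvPolynomial.X (i.succ.natAdd 2) - MvPolynomial.X 2)) X (by
        rw [aevalAeval_Y]
        simp [hz, framePoint, Fin.sum_univ_two, Fin.natAdd])
    rw [evalEval_X] at this
    simp only [map_add, map_mul, map_sub, MvPolynomial.eval_X, MvPolynomial.eval_C,
      Fin.sum_univ_two] at this ⊢
    linear_combination this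
  obtain ⟨h2, h34⟩ := hs _ hζF hζs
  have hζz : ζ = framePoint t y w := by
    have h3 := h34 0
    have h4 := h34 1
    funext i
    fin_cases i
    · exact hζ0
    · exact hζ1
    · exact h2
    · have : ζ 3 = y + w 0 := by rw [← h2, ← h3]; simp [Fin.natAdd]
      exact this
    · have : ζ 4 = y + w 1 := by rw [← h2, ← h4]; simp [Fin.natAdd]
      exact this
  rw [← hζz]
  simpa using hζ g 0 (by rw [hg, map_zero])

/-- The curve reconstructed from a family of plane curves through the projections of more than
`k ^ 3` points: it has degree at most `k` and contains the points. The matrix `M` expresses the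
homogeneous coordinates of a point by its coordinates in the frame of the family. -/
theorem exists_curve_of_family {ι : Type} {k : ℕ} (hk : 1 ≤ k)
    (c : ℕ × ℕ → MvPolynomial (Fin 2) ℂ)
    (hirr : Irreducible (planePoly k fun e => MvPolynomial.eval 0 (c e)))
    (htop : ∀ j, MvPolynomial.eval (corner j) (c (0, k)) ≠ 0)
    (hgen : ∀ᶠ s in zariskiGeneric (Fin 2),
      Irreducible (planePoly k fun e => MvPolynomial.eval s (c e)) ∧
        MvPolynomial.eval s (c (0, k)) ≠ 0)
    (S : Finset ι) (t y : ι → ℂ) (w : ι → Fin 2 → ℂ)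
    (ht : Set.InjOn t S) (hS : k * (k * k) < S.card)
    (h : ∀ p ∈ S, ∀ s : Fin 2 → ℂ, (planePoly k fun e => MvPolynomial.eval s (c e)).evalEval
      (t p) (y p + ∑ i, s i * w p i) = 0)
    (M : Matrix (Fin 5) (Fin 5) ℂ) (hM : IsUnit M.det) :
    ∃ (Z : Set (PSpace 4)) (e : ℕ), 1 ≤ e ∧ e ≤ k ∧ IsCurveOfDegree Z e ∧
      ∀ p ∈ S, ∀ (v : Fin 5 → ℂ) (hv : v ≠ 0), v = M.mulVec (framePoint (t p) (y p) (w p)) →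
        Projectivization.mk ℂ v hv ∈ Z := by
  obtain ⟨K, _, _, τ, η, u, δ, hτ, hδ0, hδ, hδu, hu⟩ :=
    exists_generic_point hk c hirr (htop 0) S t y w ht hS h
  set z := framePoint τ η u with hz
  set x : Fin (4 + 1) → K := (M.map (algebraMap ℂ K)).mulVec z with hx
  set V := Submodule.span ℂ (Set.range z) with hV
  have hxV : Submodule.span ℂ (Set.range x) = V := by
    have hmap : ∀ (N : Matrix (Fin 5) (Fin 5) ℂ) (a : Fin 5 → K),
        Submodule.span ℂ (Set.range ((N.map (algebraMap ℂ K)).mulVec a)) ≤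
          Submodule.span ℂ (Set.range a) := by
      intro N a
      rw [Submodule.span_le]
      rintro _ ⟨i, rfl⟩
      change ∑ j, N.map (algebraMap ℂ K) i j * a j ∈ Submodule.span ℂ (Set.range a)
      refine Submodule.sum_mem _ fun j _ => ?_
      rw [Matrix.map_apply, ← Algebra.smul_def]
      exact Submodule.smul_mem _ _ (Submodule.subset_span ⟨j, rfl⟩)
    refine le_antisymm (hmap M z) ?_
    have := hmap M⁻¹ x
    rwa [hx, Matrix.mulVec_mulVec, ← Matrix.map_mul, Matrix.nonsing_inv_mul _ hM,
      Matrix.map_one _ (map_zero _) (map_one _), Matrix.one_mulVec] at this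
  have hzV : ∀ i, z i ∈ V := fun i => Submodule.subset_span ⟨i, rfl⟩
  have hVsup : V = Submodule.span ℂ {1, τ} ⊔ Submodule.span ℂ {z 2} ⊔
      Submodule.span ℂ {z 3} ⊔ Submodule.span ℂ {z 4} := by
    have hle : ∀ i, Submodule.span ℂ {z i} ≤ V := fun i =>
      (Submodule.span_singleton_le_iff_mem _ _).2 (hzV i)
    apply le_antisymm
    · rw [hV, Submodule.span_le, ← Submodule.span_union, ← Submodule.span_union,
        ← Submodule.span_union]
      rintro _ ⟨i, rfl⟩
      refine Submodule.subset_span ?_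
      fin_cases i <;> simp [hz, framePoint]
    · refine sup_le (sup_le (sup_le ?_ (hle 2)) (hle 3)) (hle 4)
      rw [Submodule.span_le]
      rintro _ (rfl | rfl)
      exacts [hzV 0, hzV 1]
  obtain ⟨l, rfl⟩ : ∃ l, k = l + 1 := ⟨k - 1, by omega⟩
  have hint : ∀ j : Fin 3, z (j.natAdd 2) ^ (l + 1) ∈ Submodule.span ℂ {1, τ} * V ^ l := by
    intro j
    refine pow_succ_mem_of_aevalAeval_eq_zero (c := fun e => MvPolynomial.eval (corner j) (c e))
      (hzV 0) (hzV 1) (hzV _) (htop j) ?_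
    rw [hz, framePoint_eq_corner]
    exact hu (corner j)
  obtain ⟨m₀, hm₀⟩ := exists_forall_pow_succ_le (fun j : Fin 3 => z (j.natAdd 2)) hVsup hint
  have hf := planePoly_mem_totalDegreeLE (l + 1) fun e => MvPolynomial.eval 0 (c e)
  have hfc := coeff_planePoly_top (l + 1) fun e => MvPolynomial.eval 0 (c e)
  have hfη : aevalAeval (R := ℂ) τ η
      (planePoly (l + 1) fun e => MvPolynomial.eval 0 (c e)) = 0 := by
    have := hu 0
    simp only [Pi.zero_apply, map_zero, zero_mul, Finset.sum_const_zero, add_zero] at this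
    exact this
  have hδmul : ∀ q ∈ totalDegreeLE 1, δ * aevalAeval (R := ℂ) τ η q ∈
      restrictedForms τ η (l + 1) := fun q hq =>
    restrictedForms_mul_le l 1 (Submodule.mul_mem_mul hδ (aevalAeval_mem_restrictedForms hq))
  have hδ1 : δ * 1 ∈ restrictedForms τ η (l + 1) := by
    simpa using hδmul 1 (one_mem_totalDegreeLE 1)
  have hδτ : δ * τ ∈ restrictedForms τ η (l + 1) := by
    simpa using hδmul (C X) C_X_mem_totalDegreeLE
  have hδη : δ * η ∈ restrictedForms τ η (l + 1) := by
    simpa using hδmul X X_mem_totalDegreeLE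
  have hδV : ∀ a ∈ V, δ * a ∈ restrictedForms τ η (l + 1) := by
    have hδηu : ∀ i, δ * (η + u i) ∈ restrictedForms τ η (l + 1) := fun i => by
      rw [mul_add]
      exact Submodule.add_mem _ hδη (hδu i)
    have hle : V ≤ (restrictedForms τ η (l + 1)).comap (LinearMap.mulLeft ℂ δ) := by
      rw [hV, Submodule.span_le]
      rintro _ ⟨i, rfl⟩
      fin_cases i
      · exact hδ1
      · exact hδτ
      · exact hδη
      · exact hδηu 0
      · exact hδηu 1
    exact hle
  obtain ⟨e, he1, hek, hcurve⟩ := exists_isCurveOfDegree_closureOfPoint hxV hτ (hzV 0) (hzV 1) hm₀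
    (restrictedForms τ η) one_mem_restrictedForms restrictedForms_mul_le
    (restrictedForms_fg hf (htop 0) hfc hfη) (finrank_restrictedForms_le hf (htop 0) hfc hfη)
    span_one_pair_le_restrictedForms hδ0 hδV
  refine ⟨closureOfPoint x, e, he1, hek, hcurve, ?_⟩
  rintro p hp v hv rfl g ⟨⟨m, hg⟩, hgx⟩
  rw [eval_rep_eq_zero_iff hg hv]
  -- Pass to the coordinates of the frame.
  set g' : MvPolynomial (Fin 5) ℂ :=
    MvPolynomial.bind₁ (fun i => ∑ j, MvPolynomial.C (M i j) * MvPolynomial.X j) g with hg'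
  have h1 : MvPolynomial.aeval z g' = 0 := by
    rw [hg', MvPolynomial.aeval_bind₁, ← hgx]
    congr 2
    ext i
    simp [hx, Matrix.mulVec, dotProduct]
  have h2 := eval_framePoint_eq_zero hτ hu htop hgen (h p hp) h1
  rw [hg', ← MvPolynomial.aeval_eq_eval, MvPolynomial.aeval_bind₁] at h2
  rw [← h2, ← MvPolynomial.aeval_eq_eval]
  change MvPolynomial.aeval _ g = _
  congr 2
  ext i
  simp [Matrix.mulVec, dotProduct]

end CurveOfFamily

/-! ### Ternary forms and conditions imposed by points -/

section PlaneForms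

/-- The value at `v` of the ternary form of degree `k` whose coefficient at
`v 0 ^ (k - i - j) * v 1 ^ i * v 2 ^ j` is `c (i, j)`. -/
def formEval {R : Type} [CommRing R] (k : ℕ) (c : ℕ × ℕ → R) (v : Fin 3 → R) : R :=
  ∑ e ∈ triangle k, c e * (v 0 ^ (k - e.1 - e.2) * v 1 ^ e.1 * v 2 ^ e.2)

theorem map_formEval {R R' : Type} [CommRing R] [CommRing R'] (φ : R →+* R') (k : ℕ)
    (c : ℕ × ℕ → R) (v : Fin 3 → R) :
    φ (formEval k c v) = formEval k (fun e => φ (c e)) fun i => φ (v i) := by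
  simp [formEval]

theorem formEval_smul {R : Type} [CommRing R] (k : ℕ) (c : ℕ × ℕ → R) (a : R) (v : Fin 3 → R) :
    formEval k c (a • v) = a ^ k * formEval k c v := by
  rw [formEval, formEval, Finset.mul_sum]
  refine Finset.sum_congr rfl fun e he => ?_
  have he' := mem_triangle.1 he
  rw [show a ^ k = a ^ (k - e.1 - e.2) * a ^ e.1 * a ^ e.2 by
    rw [← pow_add, ← pow_add]; congr 1; omega]
  simp only [Pi.smul_apply, smul_eq_mul, mul_pow]
  ring

theorem formEval_zero_zero_one {R : Type} [CommRing R] (k : ℕ) (c : ℕ × ℕ → R) :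
    formEval k c ![0, 0, 1] = c (0, k) := by
  rw [formEval, Finset.sum_eq_single (0, k)]
  · simp
  · rintro ⟨i, j⟩ he hne
    have he' := mem_triangle.1 he
    simp only at he'
    rcases Nat.eq_zero_or_pos i with rfl | hi
    · have : k - j ≠ 0 := by
        intro h0
        exact hne (by rw [show j = k by omega])
      simp [zero_pow this]
    · simp [zero_pow hi.ne']
  · exact fun h => absurd (mem_triangle.2 (by simp)) h

theorem formEval_one_eq_evalEval (k : ℕ) (c : ℕ × ℕ → ℂ) (t y : ℂ) :
    formEval k c ![1, t, y] = (planePoly k c).evalEval t y := by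
  rw [evalEval_planePoly, formEval]
  refine Finset.sum_congr rfl fun e _ => ?_
  simp
  ring

/-- The exponents, in three variables, of the monomial of degree `k` with index `e`. -/
noncomputable def ternaryExponent (k : ℕ) (e : ℕ × ℕ) : Fin 3 →₀ ℕ :=
  Finsupp.equivFunOnFinite.symm ![k - e.1 - e.2, e.1, e.2]

theorem eval_eq_formEval {R : Type} [CommRing R] {k : ℕ} {F : MvPolynomial (Fin 3) R}
    (hF : F.IsHomogeneous k) (v : Fin 3 → R) :
    MvPolynomial.eval v F = formEval k (fun e => F.coeff (ternaryExponent k e)) v := by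
  classical
  have hdeg : ∀ d ∈ F.support, d 0 + d 1 + d 2 = k := by
    intro d hd
    have := hF (MvPolynomial.mem_support_iff.1 hd)
    rw [Finsupp.weight_apply, Finsupp.sum_fintype _ _ (fun _ => by simp)] at this
    simpa [Fin.sum_univ_three] using this
  have hinj : Set.InjOn (ternaryExponent k) (triangle k) := by
    intro e _ e' _ h
    have h1 := DFunLike.congr_fun h 1
    have h2 := DFunLike.congr_fun h 2
    exact Prod.ext h1 h2
  rw [MvPolynomial.eval_eq', formEval, Finset.sum_subset (s₂ := (triangle k).image
    (ternaryExponent k)) (f := fun d => F.coeff d * ∏ i, v i ^ d i), Finset.sum_image hinj]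
  · refine Finset.sum_congr rfl fun e _ => ?_
    rw [Fin.prod_univ_three]
    rfl
  · intro d hd
    have := hdeg d hd
    refine Finset.mem_image.2 ⟨(d 1, d 2), mem_triangle.2 (by simp only; omega), ?_⟩
    ext i
    fin_cases i
    · change k - d 1 - d 2 = d 0
      omega
    · rfl
    · rfl
  · intro d _ hd
    rw [MvPolynomial.notMem_support_iff.1 hd, zero_mul]

theorem eq_zero_of_coeff_ternaryExponent {R : Type} [CommRing R] {k : ℕ}
    {F : MvPolynomial (Fin 3) R} (hF : F.IsHomogeneous k)
    (h : ∀ e ∈ triangle k, F.coeff (ternaryExponent k e) = 0) : F = 0 := by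
  ext d
  rw [MvPolynomial.coeff_zero]
  by_contra hd
  have hdeg : d 0 + d 1 + d 2 = k := by
    have := hF hd
    rw [Finsupp.weight_apply, Finsupp.sum_fintype _ _ (fun _ => by simp)] at this
    simpa [Fin.sum_univ_three] using this
  refine hd ?_
  have he : ternaryExponent k (d 1, d 2) = d := by
    ext i
    fin_cases i
    · change k - d 1 - d 2 = d 0
      omega
    · rfl
    · rfl
  rw [← he]
  exact h _ (mem_triangle.2 (by simp only; omega))

/-- The ternary form of degree `k` with coefficients `c`, as a polynomial. -/
noncomputable def ternaryForm {R : Type} [CommRing R] (k : ℕ) (c : ℕ × ℕ → R) :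
    MvPolynomial (Fin 3) R :=
  formEval k (fun e => MvPolynomial.C (c e)) MvPolynomial.X

theorem ternaryForm_isHomogeneous {R : Type} [CommRing R] (k : ℕ) (c : ℕ × ℕ → R) :
    (ternaryForm k c).IsHomogeneous k := by
  refine MvPolynomial.IsHomogeneous.sum _ _ _ fun e he => ?_
  have he' := mem_triangle.1 he
  have := (MvPolynomial.isHomogeneous_C (Fin 3) (c e)).mul
    ((((MvPolynomial.isHomogeneous_X R (0 : Fin 3)).pow (k - e.1 - e.2)).mul
      ((MvPolynomial.isHomogeneous_X R (1 : Fin 3)).pow e.1)).mul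
      ((MvPolynomial.isHomogeneous_X R (2 : Fin 3)).pow e.2))
  convert this using 1
  omega

theorem eval_ternaryForm {R : Type} [CommRing R] (k : ℕ) (c : ℕ × ℕ → R) (v : Fin 3 → R) :
    MvPolynomial.eval v (ternaryForm k c) = formEval k c v := by
  rw [ternaryForm, map_formEval]
  simp

theorem coeff_ternaryForm {R : Type} [CommRing R] (k : ℕ) (c : ℕ × ℕ → R) {e : ℕ × ℕ}
    (he : e ∈ triangle k) : (ternaryForm k c).coeff (ternaryExponent k e) = c e := by
  classical
  have hmono : ∀ e' : ℕ × ℕ, (MvPolynomial.C (c e') * (MvPolynomial.X 0 ^ (k - e'.1 - e'.2) *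
      MvPolynomial.X 1 ^ e'.1 * MvPolynomial.X 2 ^ e'.2) : MvPolynomial (Fin 3) R) =
      MvPolynomial.monomial (ternaryExponent k e') (c e') := by
    intro e'
    rw [MvPolynomial.monomial_eq, Finsupp.prod_fintype _ _ (fun _ => pow_zero _),
      Fin.prod_univ_three]
    rfl
  rw [ternaryForm, formEval]
  simp only [hmono, MvPolynomial.coeff_sum, MvPolynomial.coeff_monomial]
  rw [Finset.sum_eq_single e]
  · simp
  · intro e' _ hne
    rw [if_neg]
    intro h
    exact hne (Prod.ext (DFunLike.congr_fun h 1) (DFunLike.congr_fun h 2))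
  · exact fun h => absurd he h

theorem eq_zero_of_formEval_eq_zero {k : ℕ} {c : ℕ × ℕ → ℂ} (h : ∀ v, formEval k c v = 0)
    {e : ℕ × ℕ} (he : e ∈ triangle k) : c e = 0 := by
  have : ternaryForm k c = 0 := MvPolynomial.funext fun v => by
    rw [eval_ternaryForm, h, map_zero]
  rw [← coeff_ternaryForm k c he, this, MvPolynomial.coeff_zero]

/-- A linear substitution in a form. -/
theorem exists_formEval_mulVec {R : Type} [CommRing R] (k : ℕ) (c : ℕ × ℕ → R)
    (g : Matrix (Fin 3) (Fin 3) R) :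
    ∃ c' : ℕ × ℕ → R, ∀ v, formEval k c' v = formEval k c (g.mulVec v) := by
  set G : MvPolynomial (Fin 3) R := MvPolynomial.aeval
    (fun i => ∑ j, MvPolynomial.C (g i j) * MvPolynomial.X j) (ternaryForm k c) with hG
  have hGh : G.IsHomogeneous k := by
    have := (ternaryForm_isHomogeneous k c).aeval
      (fun i => ∑ j, MvPolynomial.C (g i j) * MvPolynomial.X j) (n := 1) (fun i =>
        MvPolynomial.IsHomogeneous.sum _ _ _ fun j _ => by
          simpa using (MvPolynomial.isHomogeneous_C (Fin 3) (g i j)).mul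
            (MvPolynomial.isHomogeneous_X R j))
    rwa [one_mul] at this
  refine ⟨fun e => G.coeff (ternaryExponent k e), fun v => ?_⟩
  rw [← eval_eq_formEval hGh, ← eval_ternaryForm, hG, ← MvPolynomial.aeval_eq_eval,
    ← MvPolynomial.aeval_eq_eval]
  change MvPolynomial.aeval v (MvPolynomial.bind₁ _ _) = MvPolynomial.aeval _ _
  rw [MvPolynomial.aeval_bind₁]
  congr 2
  ext i
  simp [Matrix.mulVec, dotProduct]

/-- No plane curve of degree `k` passes through the points of the plane with homogeneous
coordinates `q p`, for `p` in `S`. -/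
def NoForm {ι : Type} (k : ℕ) (S : Finset ι) (q : ι → Fin 3 → ℂ) : Prop :=
  ∀ c : ℕ × ℕ → ℂ, (∀ p ∈ S, formEval k c (q p) = 0) → ∀ e ∈ triangle k, c e = 0

/-- The condition does not depend on the choice of homogeneous coordinates. -/
theorem NoForm.of_smul {ι : Type} {k : ℕ} {S : Finset ι} {q q' : ι → Fin 3 → ℂ}
    (h : NoForm k S q) (a : ι → ℂ) (hq : ∀ p ∈ S, q p = a p • q' p) : NoForm k S q' := by
  intro c hc
  refine h c fun p hp => ?_
  rw [hq p hp, formEval_smul, hc p hp, mul_zero]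

theorem NoForm.linearEquiv {ι : Type} {k : ℕ} {S : Finset ι} {q : ι → Fin 3 → ℂ}
    (h : NoForm k S q) (φ : (Fin 3 → ℂ) ≃ₗ[ℂ] (Fin 3 → ℂ)) : NoForm k S fun p => φ (q p) := by
  intro c hc
  obtain ⟨c', hc'⟩ := exists_formEval_mulVec k c (LinearMap.toMatrix' φ.toLinearMap)
  have hφ : ∀ v, formEval k c' v = formEval k c (φ v) := by
    intro v
    rw [hc', LinearMap.toMatrix'_mulVec]
    rfl
  have h0 := h c' fun p hp => (hφ _).trans (hc p hp)
  refine fun e he => eq_zero_of_formEval_eq_zero (fun v => ?_) he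
  rw [← φ.apply_symm_apply v, ← hφ, formEval]
  exact Finset.sum_eq_zero fun e he => by rw [h0 e he, zero_mul]

/-- The matrix of the values of the monomials of degree `k` at the points of `S`. -/
noncomputable def veroneseMatrix {ι R : Type} [CommRing R] (k : ℕ) (S : Finset ι)
    (q : ι → Fin 3 → R) : Matrix S (triangle k) R :=
  Matrix.of fun p e => q p 0 ^ (k - e.1.1 - e.1.2) * q p 1 ^ e.1.1 * q p 2 ^ e.1.2

theorem veroneseMatrix_mulVec {ι R : Type} [CommRing R] (k : ℕ) (S : Finset ι)
    (q : ι → Fin 3 → R) (c : ℕ × ℕ → R) (p : S) :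
    (veroneseMatrix k S q).mulVec (fun e => c e) p = formEval k c (q p) := by
  rw [formEval, ← Finset.sum_coe_sort]
  simp only [veroneseMatrix, Matrix.mulVec, dotProduct, Matrix.of_apply]
  exact Finset.sum_congr rfl fun e _ => mul_comm _ _

theorem noForm_iff_mulVec {ι : Type} {k : ℕ} {S : Finset ι} {q : ι → Fin 3 → ℂ} :
    NoForm k S q ↔ ∀ c : triangle k → ℂ, (veroneseMatrix k S q).mulVec c = 0 → c = 0 := by
  classical
  constructor
  · intro h c hc
    have hext : (fun e : triangle k => (fun e : ℕ × ℕ =>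
        if he : e ∈ triangle k then c ⟨e, he⟩ else 0) e) = c := by
      ext e
      simp
    have := h (fun e => if he : e ∈ triangle k then c ⟨e, he⟩ else 0) fun p hp => by
      rw [← veroneseMatrix_mulVec k S q _ ⟨p, hp⟩, hext, hc]
      rfl
    ext e
    simpa using this e e.2
  · intro h c hc e he
    have := h (fun e => c e) (funext fun p => by
      rw [veroneseMatrix_mulVec, hc p p.2]; rfl)
    exact congrFun this ⟨e, he⟩

theorem map_veroneseMatrix {ι σ : Type} (k : ℕ) (S : Finset ι)
    (Q : ι → Fin 3 → MvPolynomial σ ℂ) (x : σ → ℂ) :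
    (veroneseMatrix k S Q).map (MvPolynomial.eval x) =
      veroneseMatrix k S fun p i => MvPolynomial.eval x (Q p i) := by
  ext p e
  simp [veroneseMatrix]

/-- That points with polynomial coordinates lie on no plane curve of degree `k` is a Zariski open
condition on the parameters. -/
theorem eventually_noForm_of_noForm {ι σ : Type} {k : ℕ} {S : Finset ι}
    (Q : ι → Fin 3 → MvPolynomial σ ℂ) {x₀ : σ → ℂ}
    (h : NoForm k S fun p i => MvPolynomial.eval x₀ (Q p i)) :
    ∀ᶠ x in zariskiGeneric σ, NoForm k S fun p i => MvPolynomial.eval x (Q p i) := by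
  simp only [noForm_iff_mulVec, ← map_veroneseMatrix] at h ⊢
  exact eventually_mulVec_injective _ h

theorem exists_formEval_eq_zero_of_not_eventually {ι σ : Type} {k : ℕ} {S : Finset ι}
    (Q : ι → Fin 3 → MvPolynomial σ ℂ)
    (h : ¬ ∀ᶠ x in zariskiGeneric σ, NoForm k S fun p i => MvPolynomial.eval x (Q p i)) :
    ∃ c : ℕ × ℕ → MvPolynomial σ ℂ, (∃ e ∈ triangle k, c e ≠ 0) ∧
      ∀ p ∈ S, formEval k c (Q p) = 0 := by
  classical
  simp only [noForm_iff_mulVec, ← map_veroneseMatrix] at h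
  obtain ⟨c, hc0, hc⟩ := exists_mulVec_eq_zero_of_not_eventually _ h
  have hext : (fun e : triangle k => (fun e : ℕ × ℕ =>
      if he : e ∈ triangle k then c ⟨e, he⟩ else 0) e) = c := by
    ext e
    simp
  obtain ⟨e, he⟩ := Function.ne_iff.1 hc0
  refine ⟨fun e => if he : e ∈ triangle k then c ⟨e, he⟩ else 0, ⟨e, e.2, by simpa using he⟩,
    fun p hp => ?_⟩
  rw [← veroneseMatrix_mulVec k S Q _ ⟨p, hp⟩, hext, hc]
  rfl

end PlaneForms

/-! ### Plane curves through generic projections -/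

section GenericProjection

open Polynomial
open scoped Polynomial.Bivariate

/-- The image of `v` under the linear map to `ℂ ^ 3` given by three linear forms. -/
def applyForms (l : Fin 3 × Fin 5 → ℂ) (v : Fin 5 → ℂ) : Fin 3 → ℂ :=
  fun i => ∑ j, l (i, j) * v j

/-- If the images of the points under every triple of linear forms lie on a plane curve of degree
`k`, then such a curve can be chosen to depend polynomially on the triple and to avoid the point
`(0 : 0 : 1)` generically. -/
theorem exists_generic_form {ι : Type} {k : ℕ} {S : Finset ι} (v : ι → Fin 5 → ℂ)
    (h : ¬ ∀ᶠ l in zariskiGeneric (Fin 3 × Fin 5), NoForm k S fun p => applyForms l (v p)) :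
    ∃ c : ℕ × ℕ → MvPolynomial (Fin 3 × Fin 5) ℂ, c (0, k) ≠ 0 ∧ ∀ p ∈ S, ∀ l,
      formEval k (fun e => MvPolynomial.eval l (c e)) (applyForms l (v p)) = 0 := by
  set Q : ι → Fin 3 → MvPolynomial (Fin 3 × Fin 5) ℂ := fun p i =>
    ∑ j, MvPolynomial.X (i, j) * MvPolynomial.C (v p j) with hQ
  have hQl : ∀ l p, (fun i => MvPolynomial.eval l (Q p i)) = applyForms l (v p) := by
    intro l p
    ext i
    simp [hQ, applyForms]
  obtain ⟨c, ⟨e, he, hce⟩, hc⟩ := exists_formEval_eq_zero_of_not_eventually (k := k) (S := S) Q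
    (by
      have hQl' : ∀ l, (fun p i => MvPolynomial.eval l (Q p i)) = fun p => applyForms l (v p) :=
        fun l => funext (hQl l)
      simpa only [hQl'] using h)
  obtain ⟨l₀, hl₀⟩ := exists_eval_ne_zero hce
  -- Move a point off the curve with parameters `l₀` to `(0 : 0 : 1)`.
  obtain ⟨w, hw⟩ : ∃ w : Fin 3 → ℂ,
      formEval k (fun e => MvPolynomial.eval l₀ (c e)) w * w 2 ≠ 0 := by
    have hne : ternaryForm k (fun e => MvPolynomial.eval l₀ (c e)) * MvPolynomial.X 2 ≠ 0 := by
      refine mul_ne_zero (fun h0 => hl₀ ?_) (MvPolynomial.X_ne_zero 2)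
      have := coeff_ternaryForm k (fun e => MvPolynomial.eval l₀ (c e)) he
      rw [h0, MvPolynomial.coeff_zero] at this
      exact this.symm
    obtain ⟨w, hw⟩ := exists_eval_ne_zero hne
    refine ⟨w, ?_⟩
    rwa [map_mul, eval_ternaryForm, MvPolynomial.eval_X] at hw
  have hw2 : w 2 ≠ 0 := right_ne_zero_of_mul hw
  set g : Matrix (Fin 3) (Fin 3) ℂ := !![1, 0, w 0; 0, 1, w 1; 0, 0, w 2] with hg
  have hgdet : IsUnit g.det := by
    rw [Matrix.det_fin_three, isUnit_iff_ne_zero]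
    simpa [hg] using hw2
  have hgw : g.mulVec ![0, 0, 1] = w := by
    ext i
    fin_cases i <;> simp [hg, Matrix.mulVec, dotProduct, Fin.sum_univ_three]
  -- The action of linear substitutions on triples of forms.
  let act : Matrix (Fin 3) (Fin 3) ℂ → (Fin 3 × Fin 5 → ℂ) → Fin 3 × Fin 5 → ℂ :=
    fun g l ij => ∑ m, g ij.1 m * l (m, ij.2)
  obtain ⟨c', hc'⟩ := exists_formEval_mulVec k (fun e => MvPolynomial.bind₁
    (fun ij : Fin 3 × Fin 5 => ∑ m, MvPolynomial.C (g ij.1 m) * MvPolynomial.X (m, ij.2)) (c e))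
    (g.map MvPolynomial.C)
  have hevalc : ∀ l (q : Fin 3 → MvPolynomial (Fin 3 × Fin 5) ℂ),
      formEval k (fun e => MvPolynomial.eval l (c' e)) (fun i => MvPolynomial.eval l (q i)) =
      formEval k (fun e => MvPolynomial.eval (act g l) (c e))
        (g.mulVec fun i => MvPolynomial.eval l (q i)) := by
    intro l q
    rw [← map_formEval, hc', map_formEval]
    congr 1
    · funext e
      rw [← MvPolynomial.aeval_eq_eval]
      rw [MvPolynomial.aeval_bind₁, ← MvPolynomial.aeval_eq_eval]
      congr 2
      ext ij
      simp [act]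
    · funext i
      simp [Matrix.mulVec, dotProduct]
  refine ⟨c', ?_, fun p hp l => ?_⟩
  · intro h0
    have h1 := hevalc (act g⁻¹ l₀) ![0, 0, 1]
    have h2 : (fun i => MvPolynomial.eval (act g⁻¹ l₀)
        ((![0, 0, 1] : Fin 3 → MvPolynomial (Fin 3 × Fin 5) ℂ) i)) = ![0, 0, 1] := by
      ext i
      fin_cases i <;> simp
    have h3 : act g (act g⁻¹ l₀) = l₀ := by
      ext ⟨i, j⟩
      simp only [act, Finset.mul_sum]
      rw [Finset.sum_comm]
      simp only [← mul_assoc, ← Finset.sum_mul]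
      have : ∀ m, ∑ x, g i x * g⁻¹ x m = (1 : Matrix (Fin 3) (Fin 3) ℂ) i m := fun m => by
        rw [← Matrix.mul_nonsing_inv g hgdet]; rfl
      simp [this, Matrix.one_apply]
    rw [h2, h3, hgw, formEval_zero_zero_one, h0, map_zero] at h1
    exact left_ne_zero_of_mul hw h1.symm
  · have h1 := hevalc l (Q p)
    have h2 : g.mulVec (applyForms l (v p)) = applyForms (act g l) (v p) := by
      ext i
      simp only [Matrix.mulVec, dotProduct, applyForms, act, Finset.mul_sum, Finset.sum_mul]
      rw [Finset.sum_comm]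
      exact Finset.sum_congr rfl fun _ _ => Finset.sum_congr rfl fun _ _ => by ring
    rw [hQl, h2, ← hQl (act g l), ← map_formEval, hc p hp, map_zero] at h1
    exact h1

theorem eq_planePoly_of_mem {k : ℕ} {f : ℂ[X][Y]} (hf : f ∈ totalDegreeLE k) :
    planePoly k (fun e => (f.coeff e.2).coeff e.1) = f := by
  ext j i
  rw [planePoly, finsetSum_coeff, finsetSum_coeff]
  simp only [coeff_C_mul_X_pow]
  have hterm : ∀ e : ℕ × ℕ, (if j = e.2 then C ((f.coeff e.2).coeff e.1) * X ^ e.1 else 0 :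
      ℂ[X]).coeff i = if e = (i, j) then (f.coeff j).coeff i else 0 := by
    rintro ⟨i', j'⟩
    by_cases hj : j = j'
    · subst hj
      by_cases hi : i = i'
      · simp [hi]
      · simp [hi, Ne.symm hi]
    · simp [hj, Ne.symm hj]
  simp only [hterm, Finset.sum_ite_eq', mem_triangle]
  split_ifs with h
  · rfl
  · exact (hf i j (by omega)).symm

theorem eq_zero_of_noForm {ι : Type} {k : ℕ} {S : Finset ι} {t y : ι → ℂ}
    (h : NoForm k S fun p => ![1, t p, y p]) {f : ℂ[X][Y]} (hf : f ∈ totalDegreeLE k)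
    (hfS : ∀ p ∈ S, f.evalEval (t p) (y p) = 0) : f = 0 := by
  have h0 := h (fun e => (f.coeff e.2).coeff e.1) fun p hp => by
    rw [formEval_one_eq_evalEval, eq_planePoly_of_mem hf, hfS p hp]
  rw [← eq_planePoly_of_mem hf, planePoly]
  exact Finset.sum_eq_zero fun e he => by simp [h0 e he]

/-- A plane curve of degree `k` through `k * m + 1` points is irreducible, if no subset of
`a * m + 1` of the points is contained in a curve of smaller degree `a`. -/
theorem irreducible_planePoly {ι : Type} {k m : ℕ} (hk : 1 ≤ k) {c : ℕ × ℕ → ℂ}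
    (hc : c (0, k) ≠ 0) {S : Finset ι} (hS : S.card = k * m + 1) {t y : ι → ℂ}
    (hcS : ∀ p ∈ S, (planePoly k c).evalEval (t p) (y p) = 0)
    (hlow : ∀ a, 1 ≤ a → a < k → ∀ S' ⊆ S, S'.card = a * m + 1 →
      NoForm a S' fun p => ![1, t p, y p]) : Irreducible (planePoly k c) := by
  classical
  set f := planePoly k c with hf
  have hfW : f ∈ totalDegreeLE k := planePoly_mem_totalDegreeLE k c
  have hfk : f.coeff k = C (c (0, k)) := coeff_planePoly_top k c
  have hdeg : f.natDegree = k := le_antisymm (natDegree_le_of_mem_totalDegreeLE hfW)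
    (le_natDegree_of_ne_zero (by rw [hfk]; simpa using hc))
  have hf0 : f ≠ 0 := by
    intro h0
    rw [h0, natDegree_zero] at hdeg
    omega
  have hlead : IsUnit f.leadingCoeff := by
    rw [leadingCoeff, hdeg, hfk]
    exact isUnit_C.2 (isUnit_iff_ne_zero.2 hc)
  rw [irreducible_iff]
  refine ⟨fun hu => ?_, fun g h hgh => ?_⟩
  · have := natDegree_eq_zero_of_isUnit hu
    omega
  · have hg0 : g ≠ 0 := by rintro rfl; exact hf0 (by rw [hgh, zero_mul])
    have hh0 : h ≠ 0 := by rintro rfl; exact hf0 (by rw [hgh, mul_zero])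
    have hsum : g.natDegree + h.natDegree = k := by rw [← hdeg, hgh, natDegree_mul hg0 hh0]
    rw [hgh, leadingCoeff_mul] at hlead
    have hunit : ∀ q : ℂ[X][Y], q.natDegree = 0 → IsUnit q.leadingCoeff → IsUnit q := by
      intro q hq hu
      rw [eq_C_of_natDegree_eq_zero hq]
      rw [leadingCoeff, hq] at hu
      exact isUnit_C.2 hu
    by_contra! hcon
    have ha : 1 ≤ g.natDegree := Nat.one_le_iff_ne_zero.2 fun h0 =>
      hcon.1 (hunit g h0 (isUnit_of_mul_isUnit_left hlead))
    have hb : 1 ≤ h.natDegree := Nat.one_le_iff_ne_zero.2 fun h0 =>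
      hcon.2 (hunit h h0 (isUnit_of_mul_isUnit_right hlead))
    have hgW : g ∈ totalDegreeLE g.natDegree :=
      mem_totalDegreeLE_of_mul hg0 hh0 (by rwa [hsum, ← hgh])
    have hhW : h ∈ totalDegreeLE h.natDegree :=
      mem_totalDegreeLE_of_mul hh0 hg0 (by rwa [add_comm, hsum, mul_comm, ← hgh])
    have hsmall : ∀ q : ℂ[X][Y], q ≠ 0 → q ∈ totalDegreeLE q.natDegree → 1 ≤ q.natDegree →
        q.natDegree < k →
        (S.filter fun p => q.evalEval (t p) (y p) = 0).card ≤ q.natDegree * m := by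
      intro q hq0 hqW hq1 hqk
      by_contra hlt
      push Not at hlt
      obtain ⟨S', hS', hcard⟩ := Finset.exists_subset_card_eq (Nat.succ_le_of_lt hlt)
      refine hq0 (eq_zero_of_noForm (hlow _ hq1 hqk S' (hS'.trans (Finset.filter_subset _ _)) hcard)
        hqW fun p hp => ?_)
      exact (Finset.mem_filter.1 (hS' hp)).2
    have h1 := hsmall g hg0 hgW ha (by omega)
    have h2 := hsmall h hh0 hhW hb (by omega)
    have hcover : S ⊆ (S.filter fun p => g.evalEval (t p) (y p) = 0) ∪
        S.filter fun p => h.evalEval (t p) (y p) = 0 := by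
      intro p hp
      have := hcS p hp
      rw [hgh, evalEval_mul, mul_eq_zero] at this
      rw [Finset.mem_union, Finset.mem_filter, Finset.mem_filter]
      tauto
    have h3 := (Finset.card_le_card hcover).trans (Finset.card_union_le _ _)
    have h4 : k * m = g.natDegree * m + h.natDegree * m := by rw [← add_mul, hsum]
    omega

end GenericProjection

/-! ### Induction on the degree -/

section Induction

open Polynomial
open scoped Polynomial.Bivariate

theorem exists_minor_ne_zero {p q : PSpace 4} (hpq : p ≠ q) :
    ∃ j l, p.rep j * q.rep l - q.rep j * p.rep l ≠ 0 := by
  by_contra! h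
  obtain ⟨j, hj⟩ := Function.ne_iff.1 p.rep_nonzero
  apply hpq
  rw [← p.mk_rep, ← q.mk_rep, Projectivization.mk_eq_mk_iff']
  obtain ⟨a, hq⟩ : ∃ a : ℂ, q.rep = a • p.rep := by
    refine ⟨q.rep j / p.rep j, ?_⟩
    ext l
    have := h j l
    simp only [Pi.zero_apply] at hj
    simp only [Pi.smul_apply, smul_eq_mul]
    field_simp
    linear_combination this
  have ha : a ≠ 0 := by
    rintro rfl
    rw [zero_smul] at hq
    exact q.rep_nonzero hq
  exact ⟨a⁻¹, by rw [hq, smul_smul, inv_mul_cancel₀ ha, one_smul]⟩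

theorem eventually_applyForms_zero_ne_zero (p : PSpace 4) :
    ∀ᶠ l in zariskiGeneric (Fin 3 × Fin 5), applyForms l p.rep 0 ≠ 0 := by
  obtain ⟨j, hj⟩ := Function.ne_iff.1 p.rep_nonzero
  refine eventually_ne_zero_of_eval (fun l => applyForms l p.rep 0)
    (∑ i, MvPolynomial.X (0, i) * MvPolynomial.C (p.rep i)) (fun l => by simp [applyForms])
    (x₀ := fun il => if il.2 = j then 1 else 0) ?_
  simpa [applyForms] using hj

theorem eventually_applyForms_minor_ne_zero {p q : PSpace 4} (hpq : p ≠ q) :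
    ∀ᶠ l in zariskiGeneric (Fin 3 × Fin 5), applyForms l p.rep 0 * applyForms l q.rep 1 -
      applyForms l q.rep 0 * applyForms l p.rep 1 ≠ 0 := by
  obtain ⟨j, i, hji⟩ := exists_minor_ne_zero hpq
  refine eventually_ne_zero_of_eval (fun l => applyForms l p.rep 0 * applyForms l q.rep 1 -
      applyForms l q.rep 0 * applyForms l p.rep 1)
    ((∑ i, MvPolynomial.X (0, i) * MvPolynomial.C (p.rep i)) *
      (∑ i, MvPolynomial.X (1, i) * MvPolynomial.C (q.rep i)) -
      (∑ i, MvPolynomial.X (0, i) * MvPolynomial.C (q.rep i)) *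
      (∑ i, MvPolynomial.X (1, i) * MvPolynomial.C (p.rep i)))
    (fun l => by simp [applyForms])
    (x₀ := fun il => if il.1 = 0 then (if il.2 = j then 1 else 0) else
      (if il.2 = i then 1 else 0)) ?_
  simpa [applyForms] using hji

/-- The triple of linear forms with parameters `s` in the two-parameter family spanned by the
rows of a matrix. -/
def frameTriple {R : Type} [CommRing R] (T : Fin 5 → Fin 5 → R) (s : Fin 2 → R) :
    Fin 3 × Fin 5 → R :=
  fun il => ![T 0 il.2, T 1 il.2,
    T 2 il.2 + ∑ i : Fin 2, s i * (T (i.succ.natAdd 2) il.2 - T 2 il.2)] il.1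

theorem frameTriple_corner (T : Fin 5 → Fin 5 → ℂ) (j : Fin 3) :
    frameTriple T (corner j) = fun il => T ((![0, 1, j.natAdd 2] : Fin 3 → Fin 5) il.1) il.2 := by
  ext ⟨i, l⟩
  fin_cases j <;> fin_cases i <;> simp [frameTriple, corner, Fin.sum_univ_two, Fin.natAdd]

theorem applyForms_frameTriple (T : Fin 5 → Fin 5 → ℂ) (s : Fin 2 → ℂ) (v : Fin 5 → ℂ)
    {t y : ℂ} {w : Fin 2 → ℂ} {a : ℂ}
    (h : (Matrix.of T).mulVec v = a • framePoint t y w) :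
    applyForms (frameTriple T s) v = a • ![1, t, y + ∑ i, s i * w i] := by
  have hrow : ∀ r, ∑ l, T r l * v l = a * framePoint t y w r := fun r => congrFun h r
  have h2 := hrow 2
  have h3 := hrow 3
  have h4 := hrow 4
  simp only [framePoint, Fin.isValue, Matrix.cons_val] at h2 h3 h4
  ext i
  fin_cases i
  · exact hrow 0
  · exact hrow 1
  · have e : applyForms (frameTriple T s) v 2 = ∑ l, T 2 l * v l +
        ∑ i : Fin 2, s i * (∑ l, T (i.succ.natAdd 2) l * v l - ∑ l, T 2 l * v l) := by
      simp only [applyForms, frameTriple, Matrix.cons_val, add_mul, Finset.sum_add_distrib,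
        Finset.sum_mul]
      rw [Finset.sum_comm]
      simp only [← Finset.sum_sub_distrib, Finset.mul_sum]
      congr 1
      exact Finset.sum_congr rfl fun _ _ => Finset.sum_congr rfl fun _ _ => by ring
    refine e.trans ?_
    rw [Fin.sum_univ_two]
    change ∑ l, T 2 l * v l + (s 0 * (∑ l, T 3 l * v l - ∑ l, T 2 l * v l) +
      s 1 * (∑ l, T 4 l * v l - ∑ l, T 2 l * v l)) = a * (y + ∑ i, s i * w i)
    rw [h2, h3, h4, Fin.sum_univ_two]
    ring

theorem eval_bind_frameTriple (T : Fin 5 → Fin 5 → ℂ) (s : Fin 2 → ℂ)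
    (Q : MvPolynomial (Fin 3 × Fin 5) ℂ) :
    MvPolynomial.eval s (MvPolynomial.bind₁
      (frameTriple (fun i j => MvPolynomial.C (T i j)) MvPolynomial.X) Q) =
      MvPolynomial.eval (frameTriple T s) Q := by
  rw [← MvPolynomial.aeval_eq_eval]
  rw [MvPolynomial.aeval_bind₁, ← MvPolynomial.aeval_eq_eval]
  congr 2
  ext ⟨i, l⟩
  fin_cases i <;> simp [frameTriple]

/-- A generic square matrix is invertible, and the triples of its rows that occur at the corners
of the family are generic. -/
theorem exists_frame {Q : MvPolynomial (Fin 3 × Fin 5) ℂ} (hQ : Q ≠ 0) :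
    ∃ T : Fin 5 → Fin 5 → ℂ, IsUnit (Matrix.of T).det ∧
      ∀ j, MvPolynomial.eval (frameTriple T (corner j)) Q ≠ 0 := by
  obtain ⟨l₀, hl₀⟩ := exists_eval_ne_zero hQ
  have h1 : ∀ᶠ x in zariskiGeneric (Fin 5 × Fin 5),
      (Matrix.of fun i j => x (i, j) : Matrix (Fin 5) (Fin 5) ℂ).det ≠ 0 := by
    refine eventually_ne_zero_of_eval
      (fun x => (Matrix.of fun i j => x (i, j) : Matrix (Fin 5) (Fin 5) ℂ).det)
      (Matrix.det (Matrix.of fun i j => MvPolynomial.X (i, j) :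
        Matrix (Fin 5) (Fin 5) (MvPolynomial (Fin 5 × Fin 5) ℂ))) (fun x => ?_)
      (x₀ := fun ij => (1 : Matrix (Fin 5) (Fin 5) ℂ) ij.1 ij.2) ?_
    · rw [RingHom.map_det]
      congr 1
      ext i j
      simp
    · have : (Matrix.of fun i j => (1 : Matrix (Fin 5) (Fin 5) ℂ) i j) = 1 := rfl
      change Matrix.det (Matrix.of fun i j => (1 : Matrix (Fin 5) (Fin 5) ℂ) i j) ≠ 0
      rw [this, Matrix.det_one]
      exact one_ne_zero
  have h2 : ∀ᶠ x in zariskiGeneric (Fin 5 × Fin 5), ∀ j : Fin 3,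
      MvPolynomial.eval (fun il : Fin 3 × Fin 5 =>
        MvPolynomial.eval x (MvPolynomial.X ((![0, 1, j.natAdd 2] : Fin 3 → Fin 5) il.1, il.2)))
        Q ≠ 0 := by
    refine Filter.eventually_all.2 fun j => eventually_comp_of_eval_ne_zero _
      (x₀ := fun rl => l₀ (![0, 1, 2, 2, 2] rl.1, rl.2)) ?_
    have e : (fun il : Fin 3 × Fin 5 => MvPolynomial.eval
        (fun rl : Fin 5 × Fin 5 => l₀ ((![0, 1, 2, 2, 2] : Fin 5 → Fin 3) rl.1, rl.2))
        (MvPolynomial.X ((![0, 1, j.natAdd 2] : Fin 3 → Fin 5) il.1, il.2))) = l₀ := by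
      ext ⟨i, l⟩
      rw [MvPolynomial.eval_X]
      fin_cases j <;> fin_cases i <;> rfl
    rwa [e]
  obtain ⟨x, hx1, hx2⟩ := (h1.and h2).exists
  refine ⟨fun i j => x (i, j), isUnit_iff_ne_zero.2 hx1, fun j => ?_⟩
  rw [frameTriple_corner]
  simpa only [MvPolynomial.eval_X] using hx2 j

/-- The points of a finite set that has few points on each space curve project generically to
points that have few points on each plane curve. The induction is on the degree `k`: the curves of
smaller degree only matter for the irreducibility of the plane curve through the projections. -/
theorem eventually_noForm {m : ℕ} (A : Finset (PSpace 4))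
    (hA : ∀ k : ℕ, 1 ≤ k → ∀ C : Set (PSpace 4), IsCurveOfDegree C k →
      ∀ B : Finset (PSpace 4), B ⊆ A → B.card = k * m + 1 → ¬ (B : Set (PSpace 4)) ⊆ C)
    (k : ℕ) (hk : 1 ≤ k) (hkm : k ^ 2 ≤ m) (S : Finset (PSpace 4)) (hSA : S ⊆ A)
    (hS : S.card = k * m + 1) :
    ∀ᶠ l in zariskiGeneric (Fin 3 × Fin 5), NoForm k S fun p => applyForms l p.rep := by
  classical
  induction k using Nat.strong_induction_on generalizing S with
  | _ k ih =>
  by_contra hnot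
  obtain ⟨c, hctop, hc⟩ := exists_generic_form (fun p : PSpace 4 => p.rep) hnot
  have hgood : ∀ᶠ l in zariskiGeneric (Fin 3 × Fin 5),
      MvPolynomial.eval l (c (0, k)) ≠ 0 ∧
      (∀ a ∈ Finset.range k, ∀ S' ∈ S.powerset, 1 ≤ a → S'.card = a * m + 1 →
        NoForm a S' fun p => applyForms l p.rep) ∧
      (∀ p ∈ S, applyForms l p.rep 0 ≠ 0) ∧
      ∀ p ∈ S, ∀ q ∈ S, p ≠ q → applyForms l p.rep 0 * applyForms l q.rep 1 -
        applyForms l q.rep 0 * applyForms l p.rep 1 ≠ 0 := by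
    refine (eventually_eval_ne_zero hctop).and (Filter.Eventually.and ?_
      (Filter.Eventually.and ?_ ?_))
    · refine (Filter.eventually_all_finset _).2 fun a ha => (Filter.eventually_all_finset _).2
        fun S' hS' => ?_
      simp only [Filter.eventually_imp_distrib_left]
      have hak := Finset.mem_range.1 ha
      exact fun ha1 hcard => ih a hak ha1 ((Nat.pow_le_pow_left hak.le 2).trans hkm) S'
        ((Finset.mem_powerset.1 hS').trans hSA) hcard
    · exact (Filter.eventually_all_finset _).2 fun p _ => eventually_applyForms_zero_ne_zero p
    · refine (Filter.eventually_all_finset _).2 fun p _ => (Filter.eventually_all_finset _).2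
        fun q _ => ?_
      simp only [Filter.eventually_imp_distrib_left]
      exact fun hpq => eventually_applyForms_minor_ne_zero hpq
  obtain ⟨Q, hQ, hQgood⟩ := eventually_zariskiGeneric_iff.1 hgood
  -- A two-parameter family of projections whose members at `corner j` are all good.
  obtain ⟨T, hT, hTQ⟩ := exists_frame hQ
  have hgood0 := hQgood _ (hTQ 0)
  -- Coordinates of the points in the frame, normalized by the first one.
  set x : PSpace 4 → Fin 5 → ℂ := fun p => (Matrix.of T).mulVec p.rep with hx
  set t : PSpace 4 → ℂ := fun p => x p 1 / x p 0 with ht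
  set y : PSpace 4 → ℂ := fun p => x p 2 / x p 0 with hy
  set w : PSpace 4 → Fin 2 → ℂ := fun p i => (x p (i.succ.natAdd 2) - x p 2) / x p 0 with hw
  have hx0 : ∀ p ∈ S, x p 0 ≠ 0 := fun p hp => hgood0.2.2.1 p hp
  have hframe : ∀ p ∈ S, (Matrix.of T).mulVec p.rep = x p 0 • framePoint (t p) (y p) (w p) := by
    intro p hp
    have h0 := hx0 p hp
    ext i
    change x p i = x p 0 * framePoint (t p) (y p) (w p) i
    fin_cases i
    · change x p 0 = x p 0 * 1
      ring
    · change x p 1 = x p 0 * (x p 1 / x p 0)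
      field_simp
    · change x p 2 = x p 0 * (x p 2 / x p 0)
      field_simp
    · change x p 3 = x p 0 * (x p 2 / x p 0 + (x p 3 - x p 2) / x p 0)
      field_simp
      ring
    · change x p 4 = x p 0 * (x p 2 / x p 0 + (x p 4 - x p 2) / x p 0)
      field_simp
      ring
  have happly : ∀ s, ∀ p ∈ S, applyForms (frameTriple T s) p.rep =
      x p 0 • ![1, t p, y p + ∑ i, s i * w p i] :=
    fun s p hp => applyForms_frameTriple T s _ (hframe p hp)
  have htinj : Set.InjOn t S := by
    intro p hp q hq hpq
    by_contra hne
    apply hgood0.2.2.2 p hp q hq hne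
    change x p 0 * x q 1 - x q 0 * x p 1 = 0
    have h0p := hx0 p hp
    have h0q := hx0 q hq
    change x p 1 / x p 0 = x q 1 / x q 0 at hpq
    rw [div_eq_div_iff h0p h0q] at hpq
    linear_combination -hpq
  set ĉ : ℕ × ℕ → MvPolynomial (Fin 2) ℂ := fun e => MvPolynomial.bind₁
    (frameTriple (fun i j => MvPolynomial.C (T i j)) MvPolynomial.X) (c e) with hĉ
  have hĉs : ∀ s e, MvPolynomial.eval s (ĉ e) = MvPolynomial.eval (frameTriple T s) (c e) :=
    fun s e => eval_bind_frameTriple T s (c e)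
  have hpts : ∀ p ∈ S, ∀ s : Fin 2 → ℂ,
      (planePoly k fun e => MvPolynomial.eval s (ĉ e)).evalEval (t p) (y p + ∑ i, s i * w p i) =
        0 := by
    intro p hp s
    have h1 := hc p hp (frameTriple T s)
    rw [happly s p hp, formEval_smul, formEval_one_eq_evalEval] at h1
    simp only [hĉs]
    exact (mul_eq_zero.1 h1).resolve_left (pow_ne_zero _ (hx0 p hp))
  have hirr : ∀ s, MvPolynomial.eval (frameTriple T s) Q ≠ 0 →
      Irreducible (planePoly k fun e => MvPolynomial.eval s (ĉ e)) := by
    intro s hs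
    obtain ⟨h1, h2, -, -⟩ := hQgood _ hs
    refine irreducible_planePoly hk (by rwa [hĉs]) hS (fun p hp => hpts p hp s) ?_
    intro a ha hak S' hS' hcard
    exact (h2 a (Finset.mem_range.2 hak) S' (Finset.mem_powerset.2 hS') ha hcard).of_smul
      (fun p => x p 0) fun p hp => happly s p (hS' hp)
  have hgen : ∀ᶠ s in zariskiGeneric (Fin 2),
      Irreducible (planePoly k fun e => MvPolynomial.eval s (ĉ e)) ∧
        MvPolynomial.eval s (ĉ (0, k)) ≠ 0 := by
    filter_upwards [eventually_ne_zero_of_eval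
      (fun s => MvPolynomial.eval (frameTriple T s) Q) _ (fun s => eval_bind_frameTriple T s Q)
      (hTQ 0)] with s hs
    exact ⟨hirr s hs, by rw [hĉs]; exact (hQgood _ hs).1⟩
  have hcard : k * (k * k) < S.card := by
    rw [hS]
    exact Nat.lt_succ_of_le (Nat.mul_le_mul_left k (by rwa [← sq]))
  obtain ⟨Z, e, he1, hek, hZ, hSZ⟩ := exists_curve_of_family hk ĉ (hirr 0 (hTQ 0))
    (fun j => by rw [hĉs]; exact (hQgood _ (hTQ j)).1) hgen S t y w htinj hcard hpts
    (Matrix.of T)⁻¹ (Matrix.isUnit_nonsing_inv_det _ hT)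
  obtain ⟨B, hBS, hB⟩ := Finset.exists_subset_card_eq
    (show e * m + 1 ≤ S.card by rw [hS]; exact Nat.succ_le_succ (Nat.mul_le_mul_right m hek))
  refine hA e he1 Z hZ B (hBS.trans hSA) hB fun p hp => ?_
  have hpS := hBS hp
  have h0 := hx0 p hpS
  have hv : (x p 0)⁻¹ • p.rep ≠ 0 := smul_ne_zero (inv_ne_zero h0) p.rep_nonzero
  have hmk : Projectivization.mk ℂ ((x p 0)⁻¹ • p.rep) hv = p := by
    conv_rhs => rw [← p.mk_rep]
    exact (Projectivization.mk_eq_mk_iff' _ _ _ _ _).2 ⟨_, rfl⟩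
  rw [← hmk]
  refine hSZ p hpS _ hv ?_
  rw [← inv_smul_smul₀ h0 (framePoint (t p) (y p) (w p)), ← hframe p hpS, Matrix.mulVec_smul,
    Matrix.mulVec_mulVec, Matrix.nonsing_inv_mul _ hT, Matrix.one_mulVec]

end Induction

/-! ### Projection from a line -/

section CentralProjection

theorem linearIndependent_coe_basis {V ι : Type} [AddCommGroup V] [Module ℂ V]
    {W : Submodule ℂ V} (b : Module.Basis ι ℂ W) : LinearIndependent ℂ fun i => (b i : V) :=
  b.linearIndependent.map' W.subtype W.ker_subtype

theorem span_range_coe_basis {V ι : Type} [AddCommGroup V] [Module ℂ V]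
    {W : Submodule ℂ V} (b : Module.Basis ι ℂ W) :
    Submodule.span ℂ (Set.range fun i => (b i : V)) = W := by
  have h : (Set.range fun i => (b i : V)) = W.subtype '' Set.range b :=
    Set.range_comp W.subtype b
  rw [h, Submodule.span_image, b.span_eq, Submodule.map_top, Submodule.range_subtype]

/-- The matrix whose rows are the three vectors `e` followed by the two vectors `u`. -/
def stacked {R : Type} (e : Fin 3 → Fin 5 → R) (u : Fin 2 → Fin 5 → R) :
    Matrix (Fin 5) (Fin 5) R :=
  Matrix.of (Fin.append e u)

theorem stacked_castAdd {R : Type} (e : Fin 3 → Fin 5 → R) (u : Fin 2 → Fin 5 → R) (i : Fin 3) :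
    stacked e u (i.castAdd 2) = e i :=
  Fin.append_left e u i

theorem stacked_natAdd {R : Type} (e : Fin 3 → Fin 5 → R) (u : Fin 2 → Fin 5 → R) (i : Fin 2) :
    stacked e u (i.natAdd 3) = u i :=
  Fin.append_right e u i

theorem det_stacked_ne_zero_iff {e : Fin 3 → Fin 5 → ℂ} {u : Fin 2 → Fin 5 → ℂ} :
    (stacked e u).det ≠ 0 ↔ LinearIndependent ℂ e ∧ LinearIndependent ℂ u ∧
      Disjoint (Submodule.span ℂ (Set.range e)) (Submodule.span ℂ (Set.range u)) := by
  have h : (stacked e u).row ∘ finSumFinEquiv = Sum.elim e u := by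
    ext i : 1
    rcases i with i | i
    · exact stacked_castAdd e u i
    · exact stacked_natAdd e u i
  rw [← isUnit_iff_ne_zero, ← Matrix.isUnit_iff_isUnit_det,
    ← Matrix.linearIndependent_rows_iff_isUnit]
  have h' := linearIndependent_equiv (R := ℂ) (finSumFinEquiv : Fin 3 ⊕ Fin 2 ≃ Fin (3 + 2))
    (f := (stacked e u).row)
  rw [h, linearIndependent_sum] at h'
  exact h'.symm

theorem isCompl_of_det_stacked_ne_zero {e : Fin 3 → Fin 5 → ℂ} {u : Fin 2 → Fin 5 → ℂ}
    (h : (stacked e u).det ≠ 0) :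
    IsCompl (Submodule.span ℂ (Set.range e)) (Submodule.span ℂ (Set.range u)) := by
  obtain ⟨he, hu, hd⟩ := det_stacked_ne_zero_iff.1 h
  refine ⟨hd, codisjoint_iff.2 (Submodule.eq_top_of_finrank_eq ?_)⟩
  have := Submodule.finrank_sup_add_finrank_inf_eq (Submodule.span ℂ (Set.range e))
    (Submodule.span ℂ (Set.range u))
  rw [hd.eq_bot, finrank_bot, finrank_span_eq_card he, finrank_span_eq_card hu] at this
  simpa using this

theorem eventually_det_stacked_ne_zero {e : Fin 3 → Fin 5 → ℂ} (he : LinearIndependent ℂ e) :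
    ∀ᶠ x in zariskiGeneric (Fin 2 × Fin 5), (stacked e fun i j => x (i, j)).det ≠ 0 := by
  obtain ⟨W, hW⟩ := Submodule.exists_isCompl (Submodule.span ℂ (Set.range e))
  have hWrank : Module.finrank ℂ W = 2 := by
    have := Submodule.finrank_add_eq_of_isCompl hW
    rw [finrank_span_eq_card he] at this
    simp only [Fintype.card_fin, Module.finrank_fin_fun] at this
    omega
  let b := Module.finBasisOfFinrankEq ℂ W hWrank
  refine eventually_ne_zero_of_eval (fun x => (stacked e fun i j => x (i, j)).det)
    (Matrix.det (stacked (fun i j => MvPolynomial.C (e i j)) fun i j => MvPolynomial.X (i, j)))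
    (fun x => ?_) (x₀ := fun ij => (b ij.1 : Fin 5 → ℂ) ij.2) (det_stacked_ne_zero_iff.2
      ⟨he, linearIndependent_coe_basis b, by
        simpa only [span_range_coe_basis b] using hW.disjoint⟩)
  rw [RingHom.map_det]
  congr 1
  ext i j
  rw [RingHom.mapMatrix_apply, Matrix.map_apply]
  refine Fin.addCases (m := 3) (n := 2) (fun i => ?_) (fun i => ?_) i
  · rw [stacked_castAdd, stacked_castAdd, MvPolynomial.eval_C]
  · rw [stacked_natAdd, stacked_natAdd, MvPolynomial.eval_X]

/-- The determinants that, by Cramer's rule, are the coordinates in the basis `e` of the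
projection of `v` from the span of `u`, up to a common factor. Unlike the projection itself, they
are polynomial in `u`. -/
def cramerCoords {R : Type} [CommRing R] (e : Fin 3 → Fin 5 → R) (u : Fin 2 → Fin 5 → R)
    (v : Fin 5 → R) : Fin 3 → R :=
  fun i => ((stacked e u).updateRow (i.castAdd 2) v).det

theorem cramerCoords_apply (e : Fin 3 → Fin 5 → ℂ) (u : Fin 2 → Fin 5 → ℂ) (a : Fin 3 → ℂ)
    {w : Fin 5 → ℂ} (hw : w ∈ Submodule.span ℂ (Set.range u)) :
    cramerCoords e u (∑ i, a i • e i + w) = (stacked e u).det • a := by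
  have hcr : ∀ v i, cramerCoords e u v i = (stacked e u).transpose.cramer v (i.castAdd 2) :=
    fun v i => (Matrix.cramer_transpose_apply _ _ _).symm
  have hrow : ∀ r, (stacked e u).transpose.cramer (stacked e u r) =
      Pi.single r (stacked e u).det := fun r => Matrix.cramer_transpose_row_self _ r
  have hU : ∀ i : Fin 3, (stacked e u).transpose.cramer w (i.castAdd 2) = 0 := by
    intro i
    have hle : Submodule.span ℂ (Set.range u) ≤
        LinearMap.ker ((LinearMap.proj (i.castAdd 2)).comp (stacked e u).transpose.cramer) := by
      rw [Submodule.span_le]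
      rintro _ ⟨j, rfl⟩
      have := hrow (j.natAdd 3)
      rw [stacked_natAdd] at this
      simp only [SetLike.mem_coe, LinearMap.mem_ker, LinearMap.comp_apply, LinearMap.proj_apply,
        this]
      refine Pi.single_eq_of_ne ?_ _
      intro h
      have := congrArg Fin.val h
      simp at this
      omega
    exact hle hw
  ext i
  rw [hcr, map_add, Pi.add_apply, hU, add_zero, map_sum, Finset.sum_apply, Finset.sum_eq_single i]
  · have := hrow (i.castAdd 2)
    rw [stacked_castAdd] at this
    rw [map_smul, this]
    simp [mul_comm]
  · intro j _ hj
    have := hrow (j.castAdd 2)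
    rw [stacked_castAdd] at this
    rw [map_smul, this, Pi.smul_apply, Pi.single_eq_of_ne, smul_zero]
    intro h
    exact hj (Fin.castAdd_injective 3 2 h).symm
  · simp

/-- If the points project generically to points on no plane curve of degree `k`, then so they do
under the projection to a fixed plane from a generic line. -/
theorem eventually_noForm_cramerCoords {ι : Type} {k : ℕ} {S : Finset ι} {v : ι → Fin 5 → ℂ}
    (h : ∀ᶠ l in zariskiGeneric (Fin 3 × Fin 5), NoForm k S fun p => applyForms l (v p))
    {e : Fin 3 → Fin 5 → ℂ} (he : LinearIndependent ℂ e) :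
    ∀ᶠ x in zariskiGeneric (Fin 2 × Fin 5),
      NoForm k S fun p => cramerCoords e (fun i j => x (i, j)) (v p) := by
  set E : (Fin 3 → ℂ) →ₗ[ℂ] (Fin 5 → ℂ) := Fintype.linearCombination ℂ e with hE
  have hEapply : ∀ a, E a = ∑ i, a i • e i := fun a => Fintype.linearCombination_apply ℂ e a
  have hEinj : LinearMap.ker E = ⊥ := by
    rw [LinearMap.ker_eq_bot]
    exact linearIndependent_iff_injective_fintypeLinearCombination.1 he
  -- A triple of forms that has this property and is nondegenerate on the plane.
  have hdet : ∀ᶠ l in zariskiGeneric (Fin 3 × Fin 5),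
      (Matrix.of fun i j => applyForms l (e j) i : Matrix (Fin 3) (Fin 3) ℂ).det ≠ 0 := by
    obtain ⟨g, hg⟩ := LinearMap.exists_leftInverse_of_injective E hEinj
    have hgl : ∀ w, applyForms (fun ij => LinearMap.toMatrix' g ij.1 ij.2) w = g w := by
      intro w
      rw [← LinearMap.toMatrix'_mulVec]
      rfl
    refine eventually_ne_zero_of_eval
      (fun l => (Matrix.of fun i j => applyForms l (e j) i : Matrix (Fin 3) (Fin 3) ℂ).det)
      (Matrix.det (Matrix.of fun i j => ∑ m, MvPolynomial.X (i, m) * MvPolynomial.C (e j m) :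
        Matrix (Fin 3) (Fin 3) (MvPolynomial (Fin 3 × Fin 5) ℂ))) (fun l => ?_)
      (x₀ := fun ij => LinearMap.toMatrix' g ij.1 ij.2) ?_
    · rw [RingHom.map_det]
      congr 1
      ext i j
      simp [applyForms]
    · have : (Matrix.of fun i j => applyForms (fun ij => LinearMap.toMatrix' g ij.1 ij.2) (e j) i :
          Matrix (Fin 3) (Fin 3) ℂ) = 1 := by
        ext i j
        have hj : g (e j) = Pi.single j 1 := by
          have h1 := DFunLike.congr_fun hg (Pi.single j 1)
          rw [LinearMap.comp_apply, hEapply] at h1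
          simpa [Pi.single_apply] using h1
        rw [Matrix.of_apply, hgl, hj, Matrix.one_apply, Pi.single_apply]
      rw [this, Matrix.det_one]
      exact one_ne_zero
  -- The projection from its kernel, which is spanned by `u`, differs by a linear isomorphism.
  obtain ⟨l, hl, hldet⟩ := (h.and hdet).exists
  set lam : (Fin 5 → ℂ) →ₗ[ℂ] (Fin 3 → ℂ) := Matrix.mulVecLin (Matrix.of fun i j => l (i, j))
    with hlam
  have hlamapply : ∀ w, lam w = applyForms l w := fun w => rfl
  have hcomp : ∀ a, lam (E a) =
      (Matrix.of fun i j => applyForms l (e j) i : Matrix (Fin 3) (Fin 3) ℂ).mulVec a := by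
    intro a
    rw [hEapply, map_sum, Finset.sum_congr rfl fun j _ => map_smul lam (a j) (e j)]
    ext i
    simp only [hlamapply]
    simp [Matrix.mulVec, dotProduct, mul_comm]
  have hinj : Function.Injective (lam.comp E) := by
    rw [← LinearMap.ker_eq_bot, LinearMap.ker_eq_bot']
    intro a ha
    exact Matrix.eq_zero_of_mulVec_eq_zero hldet (by rw [← hcomp]; exact ha)
  let φ : (Fin 3 → ℂ) ≃ₗ[ℂ] (Fin 3 → ℂ) := LinearEquiv.ofInjectiveEndo (lam.comp E) hinj
  have hφ : ∀ a, φ a = lam (E a) := fun a => rfl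
  have hsurj : LinearMap.range lam = ⊤ := by
    rw [LinearMap.range_eq_top]
    intro a
    exact ⟨E (φ.symm a), by rw [← hφ, φ.apply_symm_apply]⟩
  have hker : Module.finrank ℂ (LinearMap.ker lam) = 2 := by
    have := LinearMap.finrank_range_add_finrank_ker lam
    rw [hsurj, finrank_top] at this
    simp only [Module.finrank_fin_fun] at this
    omega
  let b := Module.finBasisOfFinrankEq ℂ (LinearMap.ker lam) hker
  set u : Fin 2 → Fin 5 → ℂ := fun i => (b i : Fin 5 → ℂ) with hu
  have hspan : Submodule.span ℂ (Set.range u) = LinearMap.ker lam := span_range_coe_basis b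
  have hudet : (stacked e u).det ≠ 0 := by
    refine det_stacked_ne_zero_iff.2 ⟨he, linearIndependent_coe_basis b, ?_⟩
    rw [hspan, Submodule.disjoint_def]
    intro w hw hw'
    rw [← Fintype.range_linearCombination] at hw
    obtain ⟨a, rfl⟩ := hw
    have : a = 0 := hinj ((LinearMap.mem_ker.1 hw').trans (map_zero _).symm)
    rw [this, map_zero]
  have hcoords : ∀ w, cramerCoords e u w = (stacked e u).det • φ.symm (applyForms l w) := by
    intro w
    have hw : w - E (φ.symm (lam w)) ∈ Submodule.span ℂ (Set.range u) := by
      rw [hspan, LinearMap.mem_ker, map_sub, ← hφ, φ.apply_symm_apply, sub_self]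
    have := cramerCoords_apply e u (φ.symm (lam w)) hw
    rwa [← hEapply, add_sub_cancel] at this
  have hu0 : NoForm k S fun p => cramerCoords e u (v p) := by
    refine (hl.linearEquiv φ.symm).of_smul (fun _ => (stacked e u).det⁻¹) fun p _ => ?_
    rw [hcoords, inv_smul_smul₀ hudet]
  have heval : ∀ (x : Fin 2 × Fin 5 → ℂ) (w : Fin 5 → ℂ),
      (fun i => MvPolynomial.eval x (cramerCoords (fun i j => MvPolynomial.C (e i j))
        (fun i j => MvPolynomial.X (i, j)) (fun j => MvPolynomial.C (w j)) i)) =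
        cramerCoords e (fun i j => x (i, j)) w := by
    intro x w
    ext i
    rw [cramerCoords, cramerCoords, RingHom.map_det, RingHom.mapMatrix_apply, Matrix.map_updateRow]
    congr 2
    · ext i j
      rw [Matrix.map_apply]
      refine Fin.addCases (m := 3) (n := 2) (fun i => ?_) (fun i => ?_) i
      · rw [stacked_castAdd, stacked_castAdd, MvPolynomial.eval_C]
      · rw [stacked_natAdd, stacked_natAdd, MvPolynomial.eval_X]
    · ext j
      simp
  have := eventually_noForm_of_noForm (k := k) (S := S) (σ := Fin 2 × Fin 5)
    (fun p => cramerCoords (fun i j => MvPolynomial.C (e i j))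
      (fun i j => MvPolynomial.X (i, j)) (fun j => MvPolynomial.C (v p j)))
    (x₀ := fun ij => u ij.1 ij.2) (by
      simp only [funext fun p => heval (fun ij => u ij.1 ij.2) (v p)]
      exact hu0)
  filter_upwards [this] with x hx
  simpa only [funext fun p => heval x (v p)] using hx

theorem exists_linearIndependent_triple_of_ne_zero {v : Fin 5 → ℂ} (hv : v ≠ 0) :
    ∃ e : Fin 3 → Fin 5 → ℂ, LinearIndependent ℂ e ∧ v ∈ Set.range e := by
  have h1 : LinearIndependent ℂ (fun _ : Fin 1 => v) :=
    linearIndependent_unique_iff.2 hv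
  obtain ⟨a, ha⟩ := exists_linearIndependent_cons_of_lt_finrank h1 (by simp)
  obtain ⟨b, hb⟩ := exists_linearIndependent_cons_of_lt_finrank ha (by simp)
  exact ⟨_, hb, ⟨2, rfl⟩⟩

theorem eventually_not_liesOn (p : PSpace 4) : ∀ᶠ x in zariskiGeneric (Fin 2 × Fin 5),
    ¬ LiesOn p (Submodule.span ℂ (Set.range fun i j => x (i, j))) := by
  obtain ⟨e, he, hpe⟩ := exists_linearIndependent_triple_of_ne_zero p.rep_nonzero
  filter_upwards [eventually_det_stacked_ne_zero he] with x hx hp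
  rw [LiesOn, Projectivization.submodule_eq, Submodule.span_singleton_le_iff_mem] at hp
  exact p.rep_nonzero (Submodule.disjoint_def.1 (det_stacked_ne_zero_iff.1 hx).2.2 _
    (Submodule.subset_span hpe) hp)

end CentralProjection

theorem corollary2p6 (d : ℕ) (hd : 3 ≤ d) (A : Finset (PSpace 4))
    (hA : ∀ k : ℕ, 1 ≤ k → ∀ C : Set (PSpace 4), IsCurveOfDegree C k →
      ∀ B : Finset (PSpace 4), B ⊆ A → B.card = k * (d - 1) + 1 → ¬ (B : Set (PSpace 4)) ⊆ C)
    (E : Submodule ℂ (Fin (4 + 1) → ℂ)) (hE : Module.finrank ℂ E = 3) :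
    ForGeneralLine (n := 4) fun U =>
      (∀ p ∈ A, ¬ LiesOn p U) ∧
      ∃ h : IsCompl E U,
        ∀ k : ℕ, 1 ≤ k → k ^ 2 + 1 ≤ d → ∀ C : Set (ℙ ℂ E), IsPlaneCurveOfDegree C k →
          (C ∩ projectionImage h (A : Set (PSpace 4))).encard ≤ ((k * (d - 1) : ℕ) : ℕ∞) := by
  classical
  let β := Module.finBasisOfFinrankEq ℂ E hE
  set e : Fin 3 → Fin 5 → ℂ := fun i => (β i : Fin 5 → ℂ) with he
  have heLI : LinearIndependent ℂ e := linearIndependent_coe_basis β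
  have hespan : Submodule.span ℂ (Set.range e) = E := span_range_coe_basis β
  have hgen : ∀ᶠ x in zariskiGeneric (Fin 2 × Fin 5),
      (∀ p ∈ A, ¬ LiesOn p (Submodule.span ℂ (Set.range fun i j => x (i, j)))) ∧
      (stacked e fun i j => x (i, j)).det ≠ 0 ∧
      ∀ k ∈ Finset.range d, ∀ S ∈ A.powerset, 1 ≤ k → k ^ 2 + 1 ≤ d → S.card = k * (d - 1) + 1 →
        NoForm k S fun p => cramerCoords e (fun i j => x (i, j)) p.rep := by
    refine ((Filter.eventually_all_finset _).2 fun p _ => eventually_not_liesOn p).and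
      ((eventually_det_stacked_ne_zero heLI).and ((Filter.eventually_all_finset _).2 fun k _ =>
        (Filter.eventually_all_finset _).2 fun S hS => ?_))
    simp only [Filter.eventually_imp_distrib_left]
    exact fun hk hkd hcard => eventually_noForm_cramerCoords
      (eventually_noForm A hA k hk (by omega) S (Finset.mem_powerset.1 hS) hcard) heLI
  obtain ⟨G, hG, hGgood⟩ := eventually_zariskiGeneric_iff.1 hgen
  refine ⟨G, hG, fun u _ hGu => ?_⟩
  obtain ⟨hA', hdet, hno⟩ := hGgood _ hGu
  change (stacked e u).det ≠ 0 at hdet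
  have hcompl := isCompl_of_det_stacked_ne_zero hdet
  rw [hespan] at hcompl
  refine ⟨hA', hcompl, fun k hk hkd C hC => ?_⟩
  obtain ⟨b, F, hF0, hF, rfl⟩ := hC
  by_contra hlt
  rw [not_le] at hlt
  obtain ⟨s, hs, hscard⟩ := Set.exists_subset_encard_eq (Order.add_one_le_of_lt hlt)
  have hsfin : s.Finite := Set.finite_of_encard_eq_coe (k := k * (d - 1) + 1) (by
    rw [hscard]; norm_cast)
  have hlift : ∀ q : ℙ ℂ E, ∃ p : PSpace 4, q ∈ s →
      p ∈ A ∧ ∃ hp : ¬ LiesOn p (Submodule.span ℂ (Set.range u)), projectFrom hcompl p hp = q := by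
    intro q
    by_cases hq : q ∈ s
    · obtain ⟨p, hp⟩ := (hs hq).2
      exact ⟨p, fun _ => hp⟩
    -- An arbitrary value.
    · exact ⟨Projectivization.mk ℂ (fun _ => 1) (fun h => one_ne_zero (congrFun h 0)),
        fun h => absurd h hq⟩
  -- The preimages `r q` form a subset of `A` with as many points as the subset `s` of the curve.
  choose r hr using hlift
  have hrinj : Set.InjOn r hsfin.toFinset := by
    intro q hq q' hq' hqq
    rw [Set.Finite.coe_toFinset] at hq hq'
    obtain ⟨-, hp, h1⟩ := hr q hq
    obtain ⟨-, hp', h2⟩ := hr q' hq'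
    rw [← h1, ← h2]
    congr 1
  have hScard : (hsfin.toFinset.image r).card = k * (d - 1) + 1 := by
    rw [Finset.card_image_of_injOn hrinj]
    have := hsfin.encard_eq_coe_toFinset_card
    rw [hscard] at this
    exact_mod_cast this.symm
  have hkd' : k < d := by nlinarith
  have hSA : hsfin.toFinset.image r ⊆ A := by
    intro p hp
    obtain ⟨q, hq, rfl⟩ := Finset.mem_image.1 hp
    exact (hr q (hsfin.mem_toFinset.1 hq)).1
  have hnoS := (hno k (Finset.mem_range.2 hkd') _ (Finset.mem_powerset.2 hSA) hk hkd
    hScard).linearEquiv (β.equivFun.symm.trans b.equivFun)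
  -- A change of basis of the plane turns Cramer's coordinates into those of the equation `F`.
  refine hF0 (eq_zero_of_coeff_ternaryExponent hF (hnoS _ fun p hp => ?_))
  obtain ⟨q, hq, rfl⟩ := Finset.mem_image.1 hp
  have hqs := hsfin.mem_toFinset.1 hq
  obtain ⟨-, hp', hpq⟩ := hr q hqs
  set v := (r q).rep with hv
  set π := Submodule.projectionOnto E _ hcompl v with hπ
  have hcoords : cramerCoords e u v = (stacked e u).det • β.equivFun π := by
    have hw : v - (π : Fin 5 → ℂ) ∈ Submodule.span ℂ (Set.range u) := by
      rw [← Submodule.projectionOnto_apply_eq_zero_iff hcompl, map_sub,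
        Submodule.projectionOnto_apply_left, sub_self]
    have h1 := cramerCoords_apply e u (β.equivFun π) hw
    have h2 : ∑ i, β.equivFun π i • e i = (π : Fin 5 → ℂ) := by
      have := congrArg E.subtype (β.sum_equivFun π)
      rwa [map_sum] at this
    rwa [h2, add_sub_cancel] at h1
  have hFq : MvPolynomial.eval (b.equivFun q.rep) F = 0 := (hs hqs).1
  rw [← hpq, projectFrom] at hFq
  obtain ⟨a, ha⟩ := Projectivization.exists_smul_eq_mk_rep ℂ π (linearProj_rep_ne_zero hcompl _ hp')
  rw [← ha, Units.smul_def, map_smul, eval_smul_of_isHomogeneous hF] at hFq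
  have hF1 := (mul_eq_zero.1 hFq).resolve_left (pow_ne_zero _ a.ne_zero)
  rw [eval_eq_formEval hF] at hF1
  change formEval k _ ((β.equivFun.symm.trans b.equivFun) (cramerCoords e u v)) = 0
  rw [hcoords, map_smul, formEval_smul, LinearEquiv.trans_apply, LinearEquiv.symm_apply_apply, hF1,
    mul_zero]
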